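/- Let $(V,\omega)$ be a finite dimensional symplectic vector space over $\mathbb{C}$ and let $\Gamma\subset Sp(V)$ be a finite group such that the triple $(V,\omega,\Gamma)$ is indecomposable, that is, there is no $\omega$-orthogonal direct sum decomposition $V=V_1\oplus V_2$ with $V_1,V_2$ proper $\Gamma$-stable symplectic vector subspaces of $V$. Let $\kappa: V\times V\to\mathbb{C}\Gamma$ be a skew-symmetric $\mathbb{C}$-bilinear pairing with values in the group algebra of $\Gamma$, and put $$\mathsf{H}_\kappa := (TV\#\Gamma)\big/\big\langle x\otimes y-y\otimes x-\kappa(x,y)\big\rangle_{x,y\in V},$$ the quotient of the smash product of the tensor algebra $TV$ with $\mathbb{C}\Gamma$ by the two-sided ideal generated by the indicated elements. Filter $\mathsf{H}_\kappa$ by placing $\mathbb{C}\Gamma$ in degree $0$ and $V$ in degree $1$: for $n\ge 0$ let $F_n(\mathsf{H}_\kappa)$ be the image of $\bigoplus_{i\le n} T^iV\otimes\mathbb{C}\Gamma$, let $F_{-1}(\mathsf{H}_\kappa)=0$, and let $\mathrm{gr}(\mathsf{H}_\kappa)=\bigoplus_{n\ge 0}F_n(\mathsf{H}_\kappa)/F_{n-1}(\mathsf{H}_\kappa)$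 be the associated graded algebra. The maps $V\to F_1/F_0$ and $\Gamma\to F_0$ extend uniquely to an algebra homomorphism $SV\#\Gamma\to\mathrm{gr}(\mathsf{H}_\kappa)$, where $SV$ is the symmetric algebra of $V$; one says that $\mathsf{H}_\kappa$ has the PBW property if this homomorphism is an isomorphism. Let $S\subset\Gamma$ be the set of symplectic reflections, i.e. of those $s\in\Gamma$ with $\mathrm{rk}(\mathrm{Id}-s)=2$. For $s\in S$ let $\omega_s$ be the skew-symmetric bilinear form on $V=\mathrm{Im}(\mathrm{Id}-s)\oplus\mathrm{Ker}(\mathrm{Id}-s)$ that coincides with $\omega$ on $\mathrm{Im}(\mathrm{Id}-s)$ and has $\mathrm{Ker}(\mathrm{Id}-s)$ as its radical. Then $\mathsf{H}_\kappa$ has the PBW property if and only if there exist a constant $t\in\mathbb{C}$ and a function $c:S\to\mathbb{C}$, $s\mapsto c_s$, invariant under conjugation by $\Gamma$, such that $$\kappa(x,y)=t\cdot\omega(x,y)\cdot 1+\sum_{s\in S}c_s\cdot\omega_s(x,y)\cdot s\qquad\text{for all }x,y\in V.$$ -/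

import Mathlib

open scoped DirectSum

noncomputable section

namespace SymplecticReflection

/-! ### The associated graded algebra of an increasing filtration -/

/-- An increasing algebra filtration `F 0 ≤ F 1 ≤ ⋯` indexed by `ℕ`,
with `1 ∈ F 0` and `F i * F j ≤ F (i + j)`. -/
structure AlgFiltration (k A : Type*) [CommRing k] [Ring A] [Algebra k A] where
  /-- The `n`-th step of the filtration. -/
  step : ℕ → Submodule k A
  mono : Monotone step
  one_mem : 1 ∈ step 0
  mul_mem : ∀ {i j : ℕ} {a b : A}, a ∈ step i → b ∈ step j → a * b ∈ step (i + j)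

namespace AlgFiltration

variable {k A : Type*} [CommRing k] [Ring A] [Algebra k A] (F : AlgFiltration k A)

/-- The preceding step `F (n - 1)`, with the convention `F (-1) = 0`. -/
def prev : ℕ → Submodule k A
  | 0 => ⊥
  | n + 1 => F.step n

/-- The graded piece `F n / F (n - 1)`. -/
def Piece (n : ℕ) : Type _ := F.step n ⧸ (F.prev n).submoduleOf (F.step n)

instance (n : ℕ) : AddCommGroup (F.Piece n) :=
  inferInstanceAs (AddCommGroup (F.step n ⧸ (F.prev n).submoduleOf (F.step n)))

instance (n : ℕ) : Module k (F.Piece n) :=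
  inferInstanceAs (Module k (F.step n ⧸ (F.prev n).submoduleOf (F.step n)))

/-- The class in `F n / F (n - 1)` of an element of `F n`. -/
def toPiece (n : ℕ) : F.step n →ₗ[k] F.Piece n :=
  Submodule.mkQ ((F.prev n).submoduleOf (F.step n))

variable {F}

lemma toPiece_surjective (n : ℕ) : Function.Surjective (F.toPiece n) :=
  Submodule.mkQ_surjective _

lemma toPiece_eq_zero {n : ℕ} {x : F.step n} : F.toPiece n x = 0 ↔ (x : A) ∈ F.prev n :=
  Submodule.Quotient.mk_eq_zero _

lemma mul_mem_prev_left {i j : ℕ} {a b : A} (ha : a ∈ F.prev i) (hb : b ∈ F.step j) :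
    a * b ∈ F.prev (i + j) := by
  cases i with
  | zero => rw [(Submodule.mem_bot k).1 ha, zero_mul]; exact zero_mem _
  | succ i => rw [Nat.succ_add]; exact F.mul_mem ha hb

lemma mul_mem_prev_right {i j : ℕ} {a b : A} (ha : a ∈ F.step i) (hb : b ∈ F.prev j) :
    a * b ∈ F.prev (i + j) := by
  cases j with
  | zero => rw [(Submodule.mem_bot k).1 hb, mul_zero]; exact zero_mem _
  | succ j => exact F.mul_mem ha hb

variable (F)

/-- The product `F i × F j → F (i + j) / F (i + j - 1)`. -/
def stepMul (i j : ℕ) : F.step i →ₗ[k] F.step j →ₗ[k] F.Piece (i + j) :=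
  LinearMap.mk₂ k (fun a b => F.toPiece (i + j) ⟨a * b, F.mul_mem a.2 b.2⟩)
    (fun a a' b => by rw [← map_add]; congr 1; ext; simp [add_mul])
    (fun c a b => by rw [← map_smul]; congr 1; ext; simp)
    (fun a b b' => by rw [← map_add]; congr 1; ext; simp [mul_add])
    (fun c a b => by rw [← map_smul]; congr 1; ext; simp)

/-- The product of graded pieces induced by the product of representatives. -/
def pieceMul (i j : ℕ) : F.Piece i →ₗ[k] F.Piece j →ₗ[k] F.Piece (i + j) :=
  Submodule.liftQ _
    (LinearMap.flip (Submodule.liftQ _ (F.stepMul i j).flip (by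
      intro b hb
      ext a
      exact toPiece_eq_zero.2 (mul_mem_prev_right a.2 hb))))
    (by
      intro a ha
      refine LinearMap.ext fun b => ?_
      obtain ⟨b, rfl⟩ := toPiece_surjective j b
      exact toPiece_eq_zero.2 (mul_mem_prev_left ha b.2))

lemma pieceMul_toPiece {i j : ℕ} (a : F.step i) (b : F.step j) :
    F.pieceMul i j (F.toPiece i a) (F.toPiece j b) =
      F.toPiece (i + j) ⟨a * b, F.mul_mem a.2 b.2⟩ := rfl

lemma gradedMonoid_mk_eq {i j : ℕ} (h : i = j) (a : F.step i) (b : F.step j)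
    (hab : (a : A) = b) :
    GradedMonoid.mk (A := F.Piece) i (F.toPiece i a) = GradedMonoid.mk j (F.toPiece j b) := by
  subst h
  rw [Subtype.ext hab]

instance : GradedMonoid.GMul F.Piece where
  mul {i j} a b := F.pieceMul i j a b

instance : GradedMonoid.GOne F.Piece where
  one := F.toPiece 0 ⟨1, F.one_mem⟩

instance : DirectSum.GRing F.Piece where
  mul_zero _ := map_zero _
  zero_mul _ := LinearMap.map_zero₂ _ _
  mul_add _ _ _ := map_add _ _ _
  add_mul _ _ _ := LinearMap.map_add₂ _ _ _ _
  one_mul := by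
    rintro ⟨i, a⟩
    obtain ⟨a, rfl⟩ := toPiece_surjective i a
    exact F.gradedMonoid_mk_eq (zero_add i) _ _ (one_mul _)
  mul_one := by
    rintro ⟨i, a⟩
    obtain ⟨a, rfl⟩ := toPiece_surjective i a
    exact F.gradedMonoid_mk_eq (add_zero i) _ _ (mul_one _)
  mul_assoc := by
    rintro ⟨i, a⟩ ⟨j, b⟩ ⟨l, c⟩
    obtain ⟨a, rfl⟩ := toPiece_surjective i a
    obtain ⟨b, rfl⟩ := toPiece_surjective j b
    obtain ⟨c, rfl⟩ := toPiece_surjective l c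
    exact F.gradedMonoid_mk_eq (add_assoc i j l) _ _ (mul_assoc _ _ _)
  natCast n := n • GradedMonoid.GOne.one
  natCast_zero := zero_smul _ _
  natCast_succ n := succ_nsmul _ n
  intCast n := n • GradedMonoid.GOne.one
  intCast_ofNat n := natCast_zsmul _ n
  intCast_negSucc_ofNat n := negSucc_zsmul _ n

instance : DirectSum.GAlgebra k F.Piece where
  toFun :=
    { toFun := fun r => r • GradedMonoid.GOne.one
      map_zero' := zero_smul _ _
      map_add' := fun r s => add_smul r s _ }
  map_one := one_smul _ _
  map_mul r s := F.gradedMonoid_mk_eq (zero_add 0).symm ((r * s) • ⟨1, F.one_mem⟩)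
    ⟨(r • (1 : A)) * (s • (1 : A)), _⟩ (by simp [mul_smul, smul_comm r s])
  commutes := by
    rintro r ⟨i, a⟩
    obtain ⟨a, rfl⟩ := toPiece_surjective i a
    exact F.gradedMonoid_mk_eq (i := 0 + i) (j := i + 0) (by simp)
      ⟨(r • (1 : A)) * a, _⟩ ⟨a * (r • (1 : A)), _⟩ (by simp)
  smul_def := by
    rintro r ⟨i, a⟩
    obtain ⟨a, rfl⟩ := toPiece_surjective i a
    exact F.gradedMonoid_mk_eq (zero_add i).symm (r • a) ⟨(r • (1 : A)) * a, _⟩ (by simp)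

/-- The associated graded algebra `gr A = ⨁ n, F n / F (n - 1)`. -/
abbrev Gr : Type _ := ⨁ n, F.Piece n

/-- The symbol in degree `n`: the class in `F n / F (n - 1) ⊆ gr A` of an element of `F n`. -/
def symbol (n : ℕ) : F.step n →ₗ[k] F.Gr := DirectSum.lof k ℕ F.Piece n ∘ₗ F.toPiece n

lemma symbol_mul {i j : ℕ} (a : F.step i) (b : F.step j) :
    F.symbol i a * F.symbol j b = F.symbol (i + j) ⟨a * b, F.mul_mem a.2 b.2⟩ :=
  DirectSum.of_mul_of _ _

lemma symbol_one : F.symbol 0 ⟨1, F.one_mem⟩ = 1 := rfl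

lemma symbol_congr {i j : ℕ} (h : i = j) (a : F.step i) (b : F.step j) (hab : (a : A) = b) :
    F.symbol i a = F.symbol j b := by
  subst h
  rw [Subtype.ext hab]

lemma symbol_eq_of_sub_mem {n : ℕ} (a b : F.step n) (h : (a : A) - b ∈ F.prev n) :
    F.symbol n a = F.symbol n b := by
  rw [← sub_eq_zero, ← map_sub]
  change DirectSum.lof k ℕ F.Piece n (F.toPiece n (a - b)) = 0
  rw [toPiece_eq_zero.2 h, map_zero]

end AlgFiltration

/-! ### Group actions on tensor and symmetric algebras, smash products -/

variable {V : Type*} [AddCommGroup V] [Module ℂ V]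

/-- A linear automorphism of `V` acts on `TV` by the algebra automorphism extending it. -/
instance : MulSemiringAction (V ≃ₗ[ℂ] V) (TensorAlgebra ℂ V) where
  smul g a := TensorAlgebra.lift ℂ (TensorAlgebra.ι ℂ ∘ₗ (g : V →ₗ[ℂ] V)) a
  one_smul a := by
    change TensorAlgebra.lift ℂ (TensorAlgebra.ι ℂ ∘ₗ LinearMap.id) a = AlgHom.id ℂ _ a
    congr 1
    ext; simp
  mul_smul g h a := by
    change TensorAlgebra.lift ℂ _ a =
      ((TensorAlgebra.lift ℂ _).comp (TensorAlgebra.lift ℂ _)) a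
    congr 1
    ext; simp
  smul_zero g := map_zero (TensorAlgebra.lift ℂ _)
  smul_add g := map_add (TensorAlgebra.lift ℂ _)
  smul_one g := map_one (TensorAlgebra.lift ℂ _)
  smul_mul g := map_mul (TensorAlgebra.lift ℂ _)

/-- A linear automorphism of `V` acts on `SV` by the algebra automorphism extending it. -/
instance : MulSemiringAction (V ≃ₗ[ℂ] V) (SymmetricAlgebra ℂ V) where
  smul g a := SymmetricAlgebra.lift (SymmetricAlgebra.ι ℂ V ∘ₗ (g : V →ₗ[ℂ] V)) a
  one_smul a := by
    change SymmetricAlgebra.lift (SymmetricAlgebra.ι ℂ V ∘ₗ LinearMap.id) a = AlgHom.id ℂ _ a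
    congr 1
    ext; simp
  mul_smul g h a := by
    change SymmetricAlgebra.lift _ a =
      ((SymmetricAlgebra.lift _).comp (SymmetricAlgebra.lift _)) a
    congr 1
    ext; simp
  smul_zero g := map_zero (SymmetricAlgebra.lift _)
  smul_add g := map_add (SymmetricAlgebra.lift _)
  smul_one g := map_one (SymmetricAlgebra.lift _)
  smul_mul g := map_mul (SymmetricAlgebra.lift _)

instance : SMulCommClass (V ≃ₗ[ℂ] V) ℂ (TensorAlgebra ℂ V) where
  smul_comm _ c a := map_smul (TensorAlgebra.lift ℂ _) c a

instance : SMulCommClass (V ≃ₗ[ℂ] V) ℂ (SymmetricAlgebra ℂ V) where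
  smul_comm _ c a := map_smul (SymmetricAlgebra.lift _) c a

lemma smul_tensor_def (g : V ≃ₗ[ℂ] V) (a : TensorAlgebra ℂ V) :
    g • a = TensorAlgebra.lift ℂ (TensorAlgebra.ι ℂ ∘ₗ (g : V →ₗ[ℂ] V)) a := rfl

lemma smul_tensor_ι (g : V ≃ₗ[ℂ] V) (x : V) :
    g • TensorAlgebra.ι ℂ x = TensorAlgebra.ι ℂ (g x) := by
  simp [smul_tensor_def]

lemma smul_symmetric_def (g : V ≃ₗ[ℂ] V) (a : SymmetricAlgebra ℂ V) :
    g • a = SymmetricAlgebra.lift (SymmetricAlgebra.ι ℂ V ∘ₗ (g : V →ₗ[ℂ] V)) a := rfl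

lemma smul_symmetric_ι (g : V ≃ₗ[ℂ] V) (x : V) :
    g • SymmetricAlgebra.ι ℂ V x = SymmetricAlgebra.ι ℂ V (g x) := by
  simp [smul_symmetric_def]

variable (Γ : Subgroup (V ≃ₗ[ℂ] V))

/-- The smash product `TV # Γ`: the skew group algebra of formal sums `∑ a_g g` with `a_g ∈ TV`,
with the multiplication `(a g) (b h) = (a (g • b)) (g h)`. -/
abbrev TensorSmash : Type _ := SkewMonoidAlgebra (TensorAlgebra ℂ V) Γ

/-- The smash product `SV # Γ`. -/
abbrev SymSmash : Type _ := SkewMonoidAlgebra (SymmetricAlgebra ℂ V) Γ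

/-- The inclusion `V → TV # Γ`. -/
def vec : V →ₗ[ℂ] TensorSmash Γ :=
  SkewMonoidAlgebra.lsingle (R := ℂ) (1 : Γ) ∘ₗ TensorAlgebra.ι ℂ

/-- The inclusion `ℂΓ → TV # Γ`. -/
def grp : MonoidAlgebra ℂ Γ →ₐ[ℂ] TensorSmash Γ :=
  MonoidAlgebra.lift ℂ (TensorSmash Γ) Γ (SkewMonoidAlgebra.of (TensorAlgebra ℂ V) Γ)

/-! ### The algebra `H_κ` and its filtration -/

variable {Γ}
variable (κ : V →ₗ[ℂ] V →ₗ[ℂ] MonoidAlgebra ℂ Γ)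

/-- The two-sided ideal of `TV # Γ` generated by all `x ⊗ y - y ⊗ x - κ(x, y)`. -/
def relIdeal : TwoSidedIdeal (TensorSmash Γ) :=
  TwoSidedIdeal.span {r | ∃ x y : V, r = vec Γ x * vec Γ y - vec Γ y * vec Γ x - grp Γ (κ x y)}

/-- The algebra `H_κ = (TV # Γ) / ⟨x ⊗ y - y ⊗ x - κ(x, y)⟩`. -/
abbrev H : Type _ := (relIdeal κ).ringCon.Quotient

/-- The quotient map `TV # Γ → H_κ`. -/
def toH : TensorSmash Γ →ₐ[ℂ] H κ := (relIdeal κ).ringCon.mkₐ ℂ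

lemma toH_eq_zero {a : TensorSmash Γ} (ha : a ∈ relIdeal κ) : toH κ a = 0 :=
  (RingCon.eq _).2 (TwoSidedIdeal.mem_iff _ _ |>.1 ha)

lemma toH_rel (x y : V) :
    toH κ (vec Γ x) * toH κ (vec Γ y) - toH κ (vec Γ y) * toH κ (vec Γ x) =
      toH κ (grp Γ (κ x y)) := by
  rw [← sub_eq_zero, ← map_mul (toH κ), ← map_mul (toH κ), ← map_sub (toH κ), ← map_sub (toH κ)]
  exact toH_eq_zero κ (TwoSidedIdeal.subset_span ⟨x, y, rfl⟩)

variable (Γ) in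
/-- The elements of `TV # Γ` of degree at most `n`, for the grading in which `Γ` has degree `0` and
`V` has degree `1`: the linear span of the `a g` with `a ∈ T^i V`, `i ≤ n`, and `g ∈ Γ`. -/
def degLE (n : ℕ) : Submodule ℂ (TensorSmash Γ) :=
  Submodule.span ℂ {r | ∃ (g : Γ) (i : ℕ) (a : TensorAlgebra ℂ V), i ≤ n ∧
    a ∈ LinearMap.range (TensorAlgebra.ι ℂ (M := V)) ^ i ∧ r = SkewMonoidAlgebra.single g a}

lemma single_mem_degLE {n i : ℕ} (hi : i ≤ n) (g : Γ) {a : TensorAlgebra ℂ V}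
    (ha : a ∈ LinearMap.range (TensorAlgebra.ι ℂ (M := V)) ^ i) :
    SkewMonoidAlgebra.single g a ∈ degLE Γ n :=
  Submodule.subset_span ⟨g, i, a, hi, ha, rfl⟩

lemma smul_mem_pow (g : V ≃ₗ[ℂ] V) (i : ℕ) {a : TensorAlgebra ℂ V}
    (ha : a ∈ LinearMap.range (TensorAlgebra.ι ℂ (M := V)) ^ i) :
    g • a ∈ LinearMap.range (TensorAlgebra.ι ℂ (M := V)) ^ i := by
  have h : (LinearMap.range (TensorAlgebra.ι ℂ (M := V))).map
      (TensorAlgebra.lift ℂ (TensorAlgebra.ι ℂ ∘ₗ (g : V →ₗ[ℂ] V))).toLinearMap ≤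
      LinearMap.range (TensorAlgebra.ι ℂ (M := V)) := by
    rintro _ ⟨_, ⟨x, rfl⟩, rfl⟩
    exact ⟨g x, by simp⟩
  have h' := Submodule.mem_map_of_mem
    (f := (TensorAlgebra.lift ℂ (TensorAlgebra.ι ℂ ∘ₗ (g : V →ₗ[ℂ] V))).toLinearMap) ha
  rw [Submodule.map_pow] at h'
  exact pow_le_pow_left' h i h'

lemma degLE_mul {i j : ℕ} {a b : TensorSmash Γ} (ha : a ∈ degLE Γ i) (hb : b ∈ degLE Γ j) :
    a * b ∈ degLE Γ (i + j) := by
  have h : degLE Γ i * degLE Γ j ≤ degLE Γ (i + j) := by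
    rw [degLE, degLE, Submodule.span_mul_span, Submodule.span_le]
    rintro _ ⟨_, ⟨g, i', a, hi, ha, rfl⟩, _, ⟨h, j', b, hj, hb, rfl⟩, rfl⟩
    simp only [SkewMonoidAlgebra.single_mul_single]
    refine single_mem_degLE (add_le_add hi hj) _ ?_
    rw [pow_add]
    exact Submodule.mul_mem_mul ha (smul_mem_pow (g : V ≃ₗ[ℂ] V) _ hb)
  exact h (Submodule.mul_mem_mul ha hb)

lemma degLE_mono : Monotone (degLE Γ) := fun _ _ hmn =>
  Submodule.span_mono fun _ ⟨g, i, a, hi, h⟩ => ⟨g, i, a, hi.trans hmn, h⟩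

/-- The increasing filtration of `H_κ` in which `ℂΓ` has degree `0` and `V` has degree `1`. -/
def filtration : AlgFiltration ℂ (H κ) where
  step n := (degLE Γ n).map (toH κ).toLinearMap
  mono _ _ h := Submodule.map_mono (degLE_mono h)
  one_mem := ⟨1, single_mem_degLE le_rfl 1 (by simp), map_one (toH κ)⟩
  mul_mem := by
    rintro i j _ _ ⟨a, ha, rfl⟩ ⟨b, hb, rfl⟩
    exact ⟨a * b, degLE_mul ha hb, map_mul (toH κ) _ _⟩

/-- The associated graded algebra `gr H_κ`. -/
abbrev GrH : Type _ := (filtration κ).Gr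

/-! ### The canonical homomorphism `SV # Γ → gr H_κ` and the PBW property -/

lemma vec_mem (x : V) : vec Γ x ∈ degLE Γ 1 :=
  single_mem_degLE le_rfl 1 (by simp)

lemma grp_mem (a : MonoidAlgebra ℂ Γ) : grp Γ a ∈ degLE Γ 0 := by
  induction a using MonoidAlgebra.induction_on with
  | of g => simpa [grp] using single_mem_degLE (n := 0) le_rfl g (a := 1) (by simp)
  | add a b ha hb => rw [map_add]; exact add_mem ha hb
  | smul r a ha => rw [map_smul]; exact Submodule.smul_mem _ _ ha

/-- The map `V → gr H_κ` sending `x` to its class in degree `1`. -/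
def grVec : V →ₗ[ℂ] GrH κ :=
  (filtration κ).symbol 1 ∘ₗ
    ((toH κ).toLinearMap ∘ₗ vec Γ).codRestrict _ (fun x => ⟨vec Γ x, vec_mem x, rfl⟩)

/-- The map `Γ → gr H_κ` sending `g` to its class in degree `0`. -/
def grGrp : Γ →* GrH κ where
  toFun g := (filtration κ).symbol 0
    ⟨toH κ (SkewMonoidAlgebra.of _ Γ g), SkewMonoidAlgebra.of _ Γ g,
      single_mem_degLE le_rfl g (by simp), rfl⟩
  map_one' := AlgFiltration.symbol_congr _ rfl _ ⟨1, (filtration κ).one_mem⟩ (by simp)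
  map_mul' g h := by
    rw [AlgFiltration.symbol_mul]
    exact AlgFiltration.symbol_congr _ rfl _ _ (by simp only [map_mul])

lemma grVec_commute (x y : V) : Commute (grVec κ x) (grVec κ y) := by
  refine (AlgFiltration.symbol_mul _ _ _).trans
    (Eq.trans ?_ (AlgFiltration.symbol_mul _ _ _).symm)
  refine AlgFiltration.symbol_eq_of_sub_mem _ _ _ ?_
  refine (filtration κ).mono (Nat.zero_le 1) ?_
  exact ⟨grp Γ (κ x y), grp_mem _, (toH_rel κ x y).symm⟩

lemma grGrp_mul_grVec (g : Γ) (x : V) :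
    grGrp κ g * grVec κ x = grVec κ ((g : V ≃ₗ[ℂ] V) x) * grGrp κ g := by
  refine (AlgFiltration.symbol_mul _ _ _).trans
    (Eq.trans ?_ (AlgFiltration.symbol_mul _ _ _).symm)
  refine AlgFiltration.symbol_congr _ rfl _ _ ?_
  change toH κ _ * toH κ _ = toH κ _ * toH κ _
  rw [← map_mul, ← map_mul]
  congr 1
  simp [vec, SkewMonoidAlgebra.single_mul_single, SkewMonoidAlgebra.lsingle, Subgroup.smul_def,
    smul_tensor_ι]

/-- The algebra homomorphism `SV → gr H_κ` extending `V → gr H_κ`. -/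
def grSym : SymmetricAlgebra ℂ V →ₐ[ℂ] GrH κ :=
  RingCon.liftₐ (TensorAlgebra.symRingCon ℂ V) (TensorAlgebra.lift ℂ (grVec κ)) (by
    refine RingCon.ringConGen_le.2 fun a b h => ?_
    obtain ⟨x, y⟩ := h
    rw [RingCon.ker_apply]
    simpa using (grVec_commute κ x y).eq)

lemma grSym_ι (x : V) : grSym κ (SymmetricAlgebra.ι ℂ V x) = grVec κ x :=
  TensorAlgebra.lift_ι_apply (grVec κ) x

lemma grSym_smul_mul (g : Γ) (a : SymmetricAlgebra ℂ V) :
    grSym κ (g • a) * grGrp κ g = grGrp κ g * grSym κ a := by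
  induction a using SymmetricAlgebra.induction with
  | algebraMap r =>
    rw [Algebra.algebraMap_eq_smul_one, smul_comm, smul_one, map_smul, map_one]
    simp
  | ι x =>
    rw [Subgroup.smul_def, smul_symmetric_ι, grSym_ι, grSym_ι, grGrp_mul_grVec]
  | mul a b ha hb => rw [smul_mul', map_mul, map_mul, mul_assoc, hb, ← mul_assoc, ha, mul_assoc]
  | add a b ha hb => rw [smul_add, map_add, map_add, add_mul, mul_add, ha, hb]

/-- The canonical algebra homomorphism `SV # Γ → gr H_κ`, sending `x ∈ V` to its class in degree `1`
and `g ∈ Γ` to its class in degree `0`. -/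
def canonicalHom : SymSmash Γ →ₐ[ℂ] GrH κ :=
  SkewMonoidAlgebra.liftNCAlgHom (grSym κ) (grGrp κ) (fun {a g} => grSym_smul_mul κ g a)

lemma canonicalHom_ι (x : V) :
    canonicalHom κ (SkewMonoidAlgebra.single 1 (SymmetricAlgebra.ι ℂ V x)) = grVec κ x := by
  change SkewMonoidAlgebra.liftNC _ _ _ = _
  rw [SkewMonoidAlgebra.liftNC_single, map_one, mul_one]
  exact grSym_ι κ x

lemma canonicalHom_of (g : Γ) :
    canonicalHom κ (SkewMonoidAlgebra.of _ Γ g) = grGrp κ g := by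
  change SkewMonoidAlgebra.liftNC _ _ _ = _
  rw [SkewMonoidAlgebra.of_apply, SkewMonoidAlgebra.liftNC_single]
  exact (congrArg (· * _) (map_one (grSym κ))).trans (one_mul _)

/-- The PBW property: the canonical homomorphism `SV # Γ → gr H_κ` is an isomorphism. -/
def PBWProperty : Prop := Function.Bijective (canonicalHom κ)

/-! ### Symplectic groups, indecomposable triples, symplectic reflections -/

/-- A symplectic form: a nondegenerate alternating bilinear form. -/
def IsSymplectic {W : Type*} [AddCommGroup W] [Module ℂ W] (ω : LinearMap.BilinForm ℂ W) : Prop :=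
  ω.IsAlt ∧ ω.Nondegenerate

/-- The symplectic group `Sp(V)` of linear automorphisms preserving `ω`. -/
def Sp (ω : LinearMap.BilinForm ℂ V) : Subgroup (V ≃ₗ[ℂ] V) where
  carrier := {g | ∀ x y, ω (g x) (g y) = ω x y}
  one_mem' _ _ := rfl
  mul_mem' {g h} hg hh x y := (hg (h x) (h y)).trans (hh x y)
  inv_mem' {g} hg x y := by
    rw [← hg]
    exact congrArg₂ (fun a b => ω a b) (g.apply_symm_apply x) (g.apply_symm_apply y)

variable (Γ) in
/-- The triple `(V, ω, Γ)` is indecomposable if there is no `ω`-orthogonal direct sum decomposition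
`V = V₁ ⊕ V₂` into proper `Γ`-stable symplectic subspaces. -/
def Indecomposable (ω : LinearMap.BilinForm ℂ V) : Prop :=
  ¬ ∃ V₁ V₂ : Submodule ℂ V, IsCompl V₁ V₂ ∧ (∀ x ∈ V₁, ∀ y ∈ V₂, ω x y = 0) ∧
    (∀ g ∈ Γ, ∀ x ∈ V₁, g x ∈ V₁) ∧ (∀ g ∈ Γ, ∀ x ∈ V₂, g x ∈ V₂) ∧
    V₁ ≠ ⊤ ∧ V₂ ≠ ⊤ ∧ IsSymplectic (ω.restrict V₁) ∧ IsSymplectic (ω.restrict V₂)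

/-- The endomorphism `Id - s`. -/
def idSub (s : V ≃ₗ[ℂ] V) : V →ₗ[ℂ] V := LinearMap.id - (s : V →ₗ[ℂ] V)

variable (Γ) in
/-- The set `S` of symplectic reflections in `Γ`: the `s` with `rk (Id - s) = 2`. -/
def reflections : Set Γ := {s | Module.finrank ℂ (LinearMap.range (idSub (s : V ≃ₗ[ℂ] V))) = 2}

/-- For `s` of finite order, `V = Im (Id - s) ⊕ Ker (Id - s)`. -/
lemma isCompl_range_ker [FiniteDimensional ℂ V] (s : V ≃ₗ[ℂ] V) (hs : IsOfFinOrder s) :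
    IsCompl (LinearMap.range (idSub s)) (LinearMap.ker (idSub s)) := by
  have hd : Disjoint (LinearMap.range (idSub s)) (LinearMap.ker (idSub s)) := by
    rw [Submodule.disjoint_def]
    rintro v ⟨u, hu⟩ hv
    have hv' : s v = v := by
      have h : v - s v = 0 := hv
      exact (sub_eq_zero.1 h).symm
    have hu' : s u = u - v := by
      have h : u - s u = v := hu
      rw [← h]; abel
    have hpow : ∀ n : ℕ, (s ^ n) u = u - (n : ℂ) • v := by
      intro n
      induction n with
      | zero => simp
      | succ n ih =>
        rw [pow_succ', LinearEquiv.mul_apply, ih, map_sub, map_smul, hv', hu', Nat.cast_succ,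
          add_smul, one_smul]
        abel
    obtain ⟨n, hn, hsn⟩ := isOfFinOrder_iff_pow_eq_one.1 hs
    have h := hpow n
    rw [hsn, LinearEquiv.coe_one, id_eq, eq_comm, sub_eq_self] at h
    exact (smul_eq_zero.1 h).resolve_left (Nat.cast_ne_zero.2 hn.ne')
  refine (Submodule.isCompl_iff_disjoint _ _ ?_).2 hd
  exact ((idSub s).finrank_range_add_finrank_ker).ge

lemma isCompl_coe [FiniteDimensional ℂ V] [Finite Γ] (s : Γ) :
    IsCompl (LinearMap.range (idSub (s : V ≃ₗ[ℂ] V))) (LinearMap.ker (idSub (s : V ≃ₗ[ℂ] V))) :=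
  isCompl_range_ker _ (Γ.subtype.isOfFinOrder (isOfFinOrder_of_finite s))

/-- The form `ω_s`: the bilinear form that coincides with `ω` on `Im (Id - s)` and vanishes when one
of the arguments is in `Ker (Id - s)`; it is the pullback of `ω` along the projection of
`V = Im (Id - s) ⊕ Ker (Id - s)` onto `Im (Id - s)`. -/
def reflForm [FiniteDimensional ℂ V] [Finite Γ] (ω : LinearMap.BilinForm ℂ V) (s : Γ) :
    LinearMap.BilinForm ℂ V :=
  ω.compl₁₂ (Submodule.projection _ _ (isCompl_coe s))
    (Submodule.projection _ _ (isCompl_coe s))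

lemma reflForm_of_mem_range [FiniteDimensional ℂ V] [Finite Γ] (ω : LinearMap.BilinForm ℂ V) (s : Γ)
    {x y : V} (hx : x ∈ LinearMap.range (idSub (s : V ≃ₗ[ℂ] V)))
    (hy : y ∈ LinearMap.range (idSub (s : V ≃ₗ[ℂ] V))) : reflForm ω s x y = ω x y := by
  have h1 := Submodule.projection_apply_left (isCompl_coe s) ⟨x, hx⟩
  have h2 := Submodule.projection_apply_left (isCompl_coe s) ⟨y, hy⟩
  simp only [reflForm, LinearMap.compl₁₂_apply]
  rw [h1, h2]

/-- For `ω` symplectic and `s ∈ Sp(V)`, the radical of `ω_s` is exactly `Ker (Id - s)`. -/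
lemma ker_reflForm [FiniteDimensional ℂ V] [Finite Γ] {ω : LinearMap.BilinForm ℂ V}
    (hω : IsSymplectic ω) (hΓ : Γ ≤ Sp ω) (s : Γ) :
    LinearMap.ker (reflForm ω s) = LinearMap.ker (idSub (s : V ≃ₗ[ℂ] V)) := by
  have hort : ∀ u v : V, v ∈ LinearMap.ker (idSub (s : V ≃ₗ[ℂ] V)) →
      ω (idSub (s : V ≃ₗ[ℂ] V) u) v = 0 := by
    intro u v hv
    have h : v - (s : V ≃ₗ[ℂ] V) v = 0 := hv
    have h' := hΓ s.2 u v
    rw [← sub_eq_zero.1 h] at h'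
    simp [idSub, h']
  have hc := isCompl_coe s
  ext x
  rw [LinearMap.mem_ker, ← Submodule.projection_apply_eq_zero_iff hc]
  constructor
  · intro h
    refine hω.2.1 _ fun y => ?_
    obtain ⟨u, hu⟩ := Submodule.projection_apply_mem hc x
    obtain ⟨y₁, hy₁, y₂, hy₂, rfl⟩ := Submodule.mem_sup.1
      (hc.sup_eq_top ▸ Submodule.mem_top : y ∈ _)
    have h1 := Submodule.projection_apply_left hc ⟨y₁, hy₁⟩
    have h2 := LinearMap.congr_fun h y₁
    simp only [reflForm, LinearMap.compl₁₂_apply] at h2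
    rw [h1] at h2
    rw [map_add, h2, ← hu, hort _ _ hy₂]
    simp
  · intro h
    ext y
    simp [reflForm, h]

end SymplecticReflection

end

/-! # The PBW theorem for symplectic reflection algebras

The proof splits at an intermediate criterion, valid for every vector space `V` and every group `Γ`
of linear automorphisms: `H_κ` has the PBW property if and only if `κ` is equivariant for
the conjugation action on `ℂΓ` and satisfies the Jacobi identity
`[κ(x, y), z] + [κ(y, z), x] + [κ(z, x), y] = 0` in `TV # Γ` (`pbwProperty_iff_jacobi`).

*Necessity of the criterion.* The canonical homomorphism sends the image in `SV # Γ` of a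
homogeneous `z ∈ TV # Γ` to the symbol of the image of `z` in `H_κ` (`canonicalHom_toSym`). Hence it
is always onto, and it is injective if and only if a homogeneous `z` whose image in `H_κ` has lower
filtration degree already vanishes in `SV # Γ` (`pbwProperty_iff`). The failure of equivariance lies
in `ℂΓ`, the failure of the Jacobi identity in `V ⊗ ℂΓ`; both die in `H_κ`, and `ℂΓ` and `V ⊗ ℂΓ`
embed in `SV # Γ`.

*Sufficiency of the criterion.* It is enough to have a linear map `Φ : TV # Γ → SV # Γ` that kills
the relations of `H_κ` and agrees with the projection `TV # Γ → SV # Γ` up to terms of lower degree.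
Take `Φ` right `ℂΓ`-linear, and let it send a word in a basis of `V` to the corresponding monomial
plus the total cost of sorting the word, where the exchange `u x y v ↦ u y x v` costs
`Φ (u κ(x, y) v)`, a value in degree lower by two (`normalForm`). Then `Φ` kills the relations
exactly when sorting costs do not depend on the path taken. Insertion sort reduces this to two
coherence conditions (`sortCost_sub_sortCost`): exchanges at disjoint positions commute, which holds
since `Φ` kills the relations in lower degree, and the braid relation for three adjacent letters,
which is the Jacobi identity. Equivariance moves group elements past the relations to the right.

*Linear algebra.* For the coefficient `β` of `g` in `κ`, the Jacobi identity reads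
`β(x, y) D z + β(y, z) D x + β(z, x) D y = 0` with `D = Id - g`. If `D` has rank at least `3` then
`β = 0`. If `D` has rank `2` then `Ker D` is in the radical of `β`, so that `β` comes from an
alternating form on the plane `Im D` and is a multiple of `ω_g`; conversely, multiples of `ω_g`
satisfy the identity. Rank `1` does not occur for elements of finite order in `Sp(V)`, and rank `0`
means `g = 1`. There the identity is void, but `β` is `Γ`-invariant, so it is `ω(A ·, ·)` for a
self-adjoint `A` that commutes with `Γ`. Subtract an eigenvalue `t` from `A`: the Fitting decomposition of `N = A - t` is
orthogonal and `Γ`-stable, so indecomposability makes `N` nilpotent, and it excludes a nonzero such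
operator of square zero (`Indecomposable.eq_zero_of_sq_eq_zero`), hence any nonzero power of `N`.
Thus `β = t ω` (`Indecomposable.exists_eq_smul`). Equivariance of `κ` is invariance of `s ↦ c_s`.
-/

noncomputable section

namespace SymplecticReflection

/-! ### Coherent sorting of words -/

section Sorting

variable {ι A : Type*} [LinearOrder ι] [AddCommGroup A]

/-- The cost of moving the letter `x`, standing between `u` and `w`, to the right past the letters
of `w` until the first one that is at least `x`. Here `c u x y v` is the cost of exchanging the
letters `x` and `y` in the word `u ++ x :: y :: v`. -/
def insertCost (c : List ι → ι → ι → List ι → A) : List ι → ι → List ι → A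
  | _, _, [] => 0
  | u, x, y :: w => if x ≤ y then 0 else c u x y w + insertCost c (u ++ [y]) x w

/-- The cost of the insertion sort of the part `w` of the word `u ++ w`. -/
def sortCost (c : List ι → ι → ι → List ι → A) : List ι → List ι → A
  | _, [] => 0
  | u, x :: w => sortCost c (u ++ [x]) w + insertCost c u x (w.insertionSort (· ≤ ·))

variable {c : List ι → ι → ι → List ι → A}

lemma insertCost_congr {c' : List ι → ι → ι → List ι → A} {n : ℕ}
    (h : ∀ u x y v, u.length + v.length + 2 = n → c u x y v = c' u x y v) (u : List ι) (x : ι)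
    (w : List ι) (hn : u.length + w.length + 1 = n) :
    insertCost c u x w = insertCost c' u x w := by
  induction w generalizing u with
  | nil => rfl
  | cons y w ih =>
    simp only [insertCost]
    rw [h u x y w (by simp at hn; omega), ih (u ++ [y]) (by simp at hn ⊢; omega)]

lemma sortCost_congr {c' : List ι → ι → ι → List ι → A} {n : ℕ}
    (h : ∀ u x y v, u.length + v.length + 2 = n → c u x y v = c' u x y v) (u w : List ι)
    (hn : u.length + w.length = n) : sortCost c u w = sortCost c' u w := by
  induction w generalizing u with
  | nil => rfl
  | cons y w ih =>
    simp only [sortCost]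
    rw [ih (u ++ [y]) (by simp at hn ⊢; omega),
      insertCost_congr h u y _ (by simp [List.length_insertionSort] at hn ⊢; omega)]

lemma insertCost_mem {S : AddSubgroup A} {n : ℕ}
    (h : ∀ u x y v, u.length + v.length + 2 = n → c u x y v ∈ S) (u : List ι) (x : ι)
    (w : List ι) (hn : u.length + w.length + 1 = n) : insertCost c u x w ∈ S := by
  induction w generalizing u with
  | nil => exact S.zero_mem
  | cons y w ih =>
    simp only [insertCost]
    split_ifs
    · exact S.zero_mem
    · exact S.add_mem (h u x y w (by simp at hn; omega))
        (ih (u ++ [y]) (by simp at hn ⊢; omega))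

lemma sortCost_mem {S : AddSubgroup A} {n : ℕ}
    (h : ∀ u x y v, u.length + v.length + 2 = n → c u x y v ∈ S) (u w : List ι)
    (hn : u.length + w.length = n) : sortCost c u w ∈ S := by
  induction w generalizing u with
  | nil => exact S.zero_mem
  | cons y w ih =>
    exact S.add_mem (ih (u ++ [y]) (by simp at hn ⊢; omega))
      (insertCost_mem h u y _ (by simp [List.length_insertionSort] at hn ⊢; omega))

/-- Costs for words of length `n` are *far-commuting* if two exchanges at disjoint positions have
the same total cost in either order. -/
def FarCommuting (n : ℕ) (c : List ι → ι → ι → List ι → A) : Prop :=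
  ∀ u x y v a b w, u.length + v.length + w.length + 4 = n →
    c u x y (v ++ a :: b :: w) + c (u ++ y :: x :: v) a b w =
      c (u ++ x :: y :: v) a b w + c u x y (v ++ b :: a :: w)

/-- Costs satisfy the *braid relation* if both ways of reversing three adjacent letters have the
same total cost. -/
def BraidRelation (c : List ι → ι → ι → List ι → A) : Prop :=
  ∀ u x y z w, c u x y (z :: w) + c (u ++ [y]) x z w + c u y z (x :: w) =
    c (u ++ [x]) y z w + c u x z (y :: w) + c (u ++ [z]) x y w

/-- An exchange to the left of `p` commutes with an insertion to the right of `p`. -/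
lemma insertCost_exchange {n : ℕ} (hcomm : FarCommuting n c) (u : List ι) (x y : ι) (p : List ι)
    (z : ι) (s : List ι) (hn : u.length + p.length + s.length + 3 = n) :
    insertCost c (u ++ x :: y :: p) z s - insertCost c (u ++ y :: x :: p) z s =
      c u x y (p ++ z :: s) - c u x y (p ++ s.orderedInsert (· ≤ ·) z) := by
  induction s generalizing p with
  | nil => simp [insertCost]
  | cons t s ih =>
    simp only [insertCost, List.orderedInsert_cons]
    split_ifs
    · simp
    · have h1 := ih (p ++ [t]) (by simp at hn ⊢; omega)
      have h2 := hcomm u x y p z t s (by simp at hn; omega)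
      simp only [List.append_assoc, List.cons_append, List.nil_append] at h1 ⊢
      rw [add_sub_add_comm, h1]
      rw [← sub_eq_zero] at h2 ⊢
      rw [← neg_eq_zero, ← h2]
      abel

/-- An exchange to the left of `p` commutes with the sorting of the word to the right of `p`. -/
lemma sortCost_exchange {n : ℕ} (hcomm : FarCommuting n c) (u : List ι) (x y : ι) (p v : List ι)
    (hn : u.length + p.length + v.length + 2 = n) :
    sortCost c (u ++ x :: y :: p) v - sortCost c (u ++ y :: x :: p) v =
      c u x y (p ++ v) - c u x y (p ++ v.insertionSort (· ≤ ·)) := by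
  induction v generalizing p with
  | nil => simp [sortCost]
  | cons z v ih =>
    have h1 := ih (p ++ [z]) (by simp at hn ⊢; omega)
    have h2 := insertCost_exchange hcomm u x y p z (v.insertionSort (· ≤ ·))
      (by simp [List.length_insertionSort] at hn ⊢; omega)
    simp only [sortCost, List.append_assoc, List.cons_append, List.nil_append,
      List.insertionSort_cons] at h1 ⊢
    rw [add_sub_add_comm, h1, h2]
    abel

/-- Inserting `y` and then `x < y` into a word, as compared with the other order. -/
lemma insertCost_swap_of_lt {n : ℕ} (hcomm : FarCommuting n c) (hbraid : BraidRelation c)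
    (u : List ι) {x y : ι} (hxy : y < x) (s : List ι) (hn : u.length + s.length + 2 = n) :
    insertCost c (u ++ [x]) y s + insertCost c u x (s.orderedInsert (· ≤ ·) y) -
      (insertCost c (u ++ [y]) x s + insertCost c u y (s.orderedInsert (· ≤ ·) x)) =
      c u x y s := by
  induction s generalizing u with
  | nil => simp [insertCost, hxy.le, hxy.not_ge]
  | cons z s ih =>
    rcases le_or_gt y z with hyz | hzy
    · by_cases hxz : x ≤ z
      · simp [insertCost, hyz, hxz, hxy.le, hxy.not_ge]
      · simp [insertCost, hyz, hxz, hxy.not_ge]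
    · have hzx := hzy.trans hxy
      have h1 := ih (u ++ [z]) (by simp at hn ⊢; omega)
      have h2 := insertCost_exchange hcomm u x z [] y s (by simp at hn ⊢; omega)
      have h3 := insertCost_exchange hcomm u y z [] x s (by simp at hn ⊢; omega)
      have h4 := hbraid u x y z s
      simp only [insertCost, List.orderedInsert_cons, hzy.not_ge, hzx.not_ge, if_false,
        List.append_assoc, List.cons_append, List.nil_append] at h1 h2 h3 ⊢
      rw [sub_eq_iff_eq_add] at h1 h2 h3 ⊢
      rw [h2, h3]
      rw [← sub_eq_zero] at h1 h4 ⊢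
      rw [← add_zero (0 : A)]
      nth_rw 1 [← neg_eq_zero.2 h4, ← h1]
      abel

/-- The total cost of sorting is a potential for the costs of single exchanges. -/
theorem sortCost_sub_sortCost {n : ℕ} (hdiag : ∀ u x v, c u x x v = 0)
    (hanti : ∀ u x y v, c u x y v = -c u y x v)
    (hcomm : FarCommuting n c) (hbraid : BraidRelation c) (u p : List ι) (x y : ι) (v : List ι)
    (hn : u.length + p.length + v.length + 2 = n) :
    sortCost c u (p ++ x :: y :: v) - sortCost c u (p ++ y :: x :: v) = c (u ++ p) x y v := by
  induction p generalizing u with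
  | cons z p ih =>
    have hsort : (p ++ x :: y :: v).insertionSort (· ≤ ·) =
        (p ++ y :: x :: v).insertionSort (· ≤ ·) := by
      refine List.Perm.eq_of_pairwise' (r := (· ≤ ·)) ?_ ?_ ?_
      · exact List.pairwise_insertionSort _ _
      · exact List.pairwise_insertionSort _ _
      · exact (List.perm_insertionSort _ _).trans
          (((List.Perm.swap y x v).append_left p).trans (List.perm_insertionSort _ _).symm)
    have h := ih (u ++ [z]) (by simp at hn ⊢; omega)
    simp only [List.cons_append, sortCost, hsort] at h ⊢
    simpa using h
  | nil =>
    have h1 := sortCost_exchange hcomm u x y [] v (by simpa using hn)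
    have hn' : u.length + (v.insertionSort (· ≤ ·)).length + 2 = n := by
      simpa [List.length_insertionSort] using hn
    have h2 : insertCost c (u ++ [x]) y (v.insertionSort (· ≤ ·)) +
        insertCost c u x ((v.insertionSort (· ≤ ·)).orderedInsert (· ≤ ·) y) -
        (insertCost c (u ++ [y]) x (v.insertionSort (· ≤ ·)) +
          insertCost c u y ((v.insertionSort (· ≤ ·)).orderedInsert (· ≤ ·) x)) =
        c u x y (v.insertionSort (· ≤ ·)) := by
      rcases lt_trichotomy x y with h | rfl | h
      · rw [hanti, ← insertCost_swap_of_lt hcomm hbraid u h _ hn']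
        abel
      · rw [sub_self, hdiag]
      · exact insertCost_swap_of_lt hcomm hbraid u h _ hn'
    simp only [sortCost, List.append_assoc, List.cons_append, List.nil_append, List.append_nil,
      List.insertionSort_cons] at h1 ⊢
    rw [← sub_add_cancel (c u x y v) (c u x y (v.insertionSort (· ≤ ·))), ← h1, ← h2]
    abel

end Sorting

section

open SkewMonoidAlgebra

variable {V : Type*} [AddCommGroup V] [Module ℂ V] {Γ : Subgroup (V ≃ₗ[ℂ] V)}

/-! ### The smash products `TV # Γ` and `SV # Γ` -/

lemma vec_apply (x : V) : vec Γ x = single 1 (TensorAlgebra.ι ℂ x) := rfl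

lemma grp_of (g : Γ) : grp Γ (MonoidAlgebra.of ℂ Γ g) = of _ Γ g := by
  simp [grp]

lemma of_mul_vec (g : Γ) (x : V) :
    of _ Γ g * vec Γ x = vec Γ ((g : V ≃ₗ[ℂ] V) x) * of _ Γ g := by
  simp [vec_apply, single_mul_single, Subgroup.smul_def, smul_tensor_ι]

variable (Γ) in
/-- The canonical surjection `TV # Γ → SV # Γ`. -/
def toSym : TensorSmash Γ →ₐ[ℂ] SymSmash Γ :=
  liftNCAlgHom
    (AlgHom.comp
      { singleOneRingHom with
        commutes' := fun r => by
          rw [coe_algebraMap]; rfl }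
      (SymmetricAlgebra.algHom ℂ V))
    (of _ Γ) (by
      intro a g
      change single 1 (SymmetricAlgebra.algHom ℂ V (g • a)) * of _ Γ g =
        of _ Γ g * single 1 (SymmetricAlgebra.algHom ℂ V a)
      have h : SymmetricAlgebra.algHom ℂ V (g • a) = g • SymmetricAlgebra.algHom ℂ V a := by
        induction a using TensorAlgebra.induction with
        | algebraMap r =>
          rw [Algebra.algebraMap_eq_smul_one, smul_comm, smul_one, map_smul, map_one, smul_comm,
            smul_one]
        | ι x =>
          change SymmetricAlgebra.algHom ℂ V (g • _) = g • SymmetricAlgebra.ι ℂ V x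
          rw [Subgroup.smul_def, Subgroup.smul_def, smul_tensor_ι, smul_symmetric_ι]
          rfl
        | mul a b ha hb => rw [smul_mul', map_mul, map_mul, ha, hb, smul_mul']
        | add a b ha hb => rw [smul_add, map_add, map_add, ha, hb, smul_add]
      simp [single_mul_single, h])

lemma toSym_single (g : Γ) (a : TensorAlgebra ℂ V) :
    toSym Γ (single g a) = single g (SymmetricAlgebra.algHom ℂ V a) := by
  change liftNC _ _ _ = _
  rw [liftNC_single]
  change single 1 (SymmetricAlgebra.algHom ℂ V a) * of _ Γ g = _
  simp [single_mul_single]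

lemma coeff_toSym (z : TensorSmash Γ) (g : Γ) :
    (toSym Γ z).coeff g = SymmetricAlgebra.algHom ℂ V (z.coeff g) := by
  classical
  induction z using SkewMonoidAlgebra.induction_on with
  | zero => simp
  | single h a =>
    rw [toSym_single, coeff_single_apply, coeff_single_apply]
    split_ifs <;> simp
  | add a b ha hb => simp [ha, hb]

lemma toSym_surjective : Function.Surjective (toSym Γ) := by
  intro s
  induction s using SkewMonoidAlgebra.induction_on with
  | zero => exact ⟨0, map_zero _⟩
  | single g a =>
    obtain ⟨a, rfl⟩ := SymmetricAlgebra.algHom_surjective ℂ V a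
    exact ⟨single g a, toSym_single g a⟩
  | add a b ha hb =>
    obtain ⟨a, rfl⟩ := ha
    obtain ⟨b, rfl⟩ := hb
    exact ⟨a + b, map_add _ _ _⟩

variable (Γ) in
/-- The homogeneous part of degree `n` of `TV # Γ`, that is `T^n V ⊗ ℂΓ`. -/
def homog (n : ℕ) : Submodule ℂ (TensorSmash Γ) :=
  Submodule.span ℂ {r | ∃ (g : Γ) (a : TensorAlgebra ℂ V),
    a ∈ LinearMap.range (TensorAlgebra.ι ℂ (M := V)) ^ n ∧ r = single g a}

lemma single_mem_homog {n : ℕ} (g : Γ) {a : TensorAlgebra ℂ V}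
    (ha : a ∈ LinearMap.range (TensorAlgebra.ι ℂ (M := V)) ^ n) : single g a ∈ homog Γ n :=
  Submodule.subset_span ⟨g, a, ha, rfl⟩

lemma homog_le_degLE {m n : ℕ} (h : m ≤ n) : homog Γ m ≤ degLE Γ n := by
  refine Submodule.span_mono ?_
  rintro _ ⟨g, a, ha, rfl⟩
  exact ⟨g, m, a, h, ha, rfl⟩

lemma degLE_eq_iSup (n : ℕ) : degLE Γ n = ⨆ i ≤ n, homog Γ i := by
  refine le_antisymm (Submodule.span_le.2 ?_) (iSup₂_le fun i hi => homog_le_degLE hi)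
  rintro _ ⟨g, i, a, hi, ha, rfl⟩
  exact (le_iSup₂_of_le (f := fun i (_ : i ≤ n) => homog Γ i) i hi le_rfl)
    (single_mem_homog g ha)

lemma mul_mem_homog {i j : ℕ} {a b : TensorSmash Γ} (ha : a ∈ homog Γ i) (hb : b ∈ homog Γ j) :
    a * b ∈ homog Γ (i + j) := by
  have h : homog Γ i * homog Γ j ≤ homog Γ (i + j) := by
    rw [homog, homog, Submodule.span_mul_span, Submodule.span_le]
    rintro _ ⟨_, ⟨g, a, ha, rfl⟩, _, ⟨h, b, hb, rfl⟩, rfl⟩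
    simp only [single_mul_single]
    refine single_mem_homog _ ?_
    rw [pow_add]
    exact Submodule.mul_mem_mul ha (smul_mem_pow (g : V ≃ₗ[ℂ] V) _ hb)
  exact h (Submodule.mul_mem_mul ha hb)

lemma of_mem_homog (g : Γ) : of _ Γ g ∈ homog Γ 0 := by
  rw [of_apply]
  exact single_mem_homog g (by simp)

lemma grp_mem_homog (a : MonoidAlgebra ℂ Γ) : grp Γ a ∈ homog Γ 0 := by
  induction a using MonoidAlgebra.induction_on with
  | of g => rw [grp_of]; exact of_mem_homog g
  | add a b ha hb => rw [map_add]; exact add_mem ha hb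
  | smul r a ha => rw [map_smul]; exact Submodule.smul_mem _ _ ha

lemma vec_mem_homog (x : V) : vec Γ x ∈ homog Γ 1 :=
  single_mem_homog 1 (by simp)

section Words

variable {ι : Type*} (b : Module.Basis ι ℂ V)

variable (Γ) in
/-- The product in `TV # Γ` of the basis vectors that a word names. -/
def word (w : List ι) : TensorSmash Γ := (w.map fun i => vec Γ (b i)).prod

@[simp] lemma word_nil : word Γ b [] = 1 := rfl

@[simp] lemma word_cons (i : ι) (w : List ι) : word Γ b (i :: w) = vec Γ (b i) * word Γ b w := by
  simp [word]

@[simp] lemma word_append (u w : List ι) : word Γ b (u ++ w) = word Γ b u * word Γ b w := by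
  simp [word]

lemma word_mem_homog (w : List ι) : word Γ b w ∈ homog Γ w.length := by
  induction w with
  | nil => simpa using of_mem_homog (1 : Γ)
  | cons i w ih =>
    rw [word_cons, List.length_cons, add_comm]
    exact mul_mem_homog (vec_mem_homog _) ih

lemma word_eq_single (w : List ι) :
    word Γ b w = single 1 (w.map fun i => TensorAlgebra.ι ℂ (b i)).prod := by
  induction w with
  | nil => rfl
  | cons i w ih => simp [ih, vec_apply, single_mul_single]

lemma range_ι_pow_eq_span (n : ℕ) :
    LinearMap.range (TensorAlgebra.ι ℂ (M := V)) ^ n = Submodule.span ℂ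
      {a | ∃ w : List ι, w.length = n ∧ a = (w.map fun i => TensorAlgebra.ι ℂ (b i)).prod} := by
  induction n with
  | zero =>
    rw [pow_zero, Submodule.one_eq_span]
    congr 1
    ext a
    simp [List.length_eq_zero_iff]
  | succ n ih =>
    have h : LinearMap.range (TensorAlgebra.ι ℂ (M := V)) =
        Submodule.span ℂ (Set.range fun i => TensorAlgebra.ι ℂ (b i)) := by
      rw [LinearMap.range_eq_map, ← b.span_eq, Submodule.map_span, ← Set.range_comp]
      rfl
    rw [pow_succ', ih, h, Submodule.span_mul_span]
    congr 1
    ext a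
    constructor
    · rintro ⟨_, ⟨i, rfl⟩, _, ⟨w, rfl, rfl⟩, rfl⟩
      exact ⟨i :: w, by simp⟩
    · rintro ⟨w, hw, rfl⟩
      obtain ⟨i, w, rfl⟩ := List.exists_cons_of_length_eq_add_one hw
      exact ⟨_, ⟨i, rfl⟩, _, ⟨w, by simpa using hw, rfl⟩, by simp⟩

lemma tensorAlgebra_basis_apply (w : List ι) :
    b.tensorAlgebra (FreeMonoid.ofList w) = (w.map fun i => TensorAlgebra.ι ℂ (b i)).prod := by
  have h : FreeAlgebra.basisFreeMonoid ℂ ι (FreeMonoid.ofList w) =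
      (w.map (FreeAlgebra.ι ℂ)).prod := by
    change MonoidAlgebra.lift ℂ (FreeAlgebra ℂ ι) (FreeMonoid ι) (FreeMonoid.lift (FreeAlgebra.ι ℂ))
      (MonoidAlgebra.single (FreeMonoid.ofList w) 1) = _
    rw [MonoidAlgebra.lift_single, one_smul, FreeMonoid.lift_ofList]
  simp only [Module.Basis.tensorAlgebra, Module.Basis.map_apply, h, AlgEquiv.toLinearEquiv_apply,
    map_list_prod, List.map_map]
  congr 2
  ext i
  simp

lemma homog_eq_span (n : ℕ) :
    homog Γ n = Submodule.span ℂ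
      {r | ∃ (w : List ι) (g : Γ), w.length = n ∧ r = word Γ b w * of _ Γ g} := by
  refine le_antisymm (Submodule.span_le.2 ?_) (Submodule.span_le.2 ?_)
  · rintro _ ⟨g, a, ha, rfl⟩
    rw [range_ι_pow_eq_span b] at ha
    have h := Submodule.mem_map_of_mem (f := lsingle (R := ℂ) g) ha
    rw [Submodule.map_span] at h
    refine Submodule.span_mono ?_ h
    rintro _ ⟨_, ⟨w, hw, rfl⟩, rfl⟩
    refine ⟨w, g, hw, ?_⟩
    rw [word_eq_single, of_apply, single_mul_single, one_mul, smul_one, mul_one]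
    rfl
  · rintro _ ⟨w, g, rfl, rfl⟩
    have h := mul_mem_homog (word_mem_homog b w) (of_mem_homog g)
    rwa [add_zero] at h

end Words

lemma iSup_homog : ⨆ n, homog Γ n = ⊤ := by
  let b := Module.Basis.ofVectorSpace ℂ V
  rw [eq_top_iff]
  rintro z -
  induction z using SkewMonoidAlgebra.induction_on with
  | zero => exact zero_mem _
  | single g a =>
    have h := b.tensorAlgebra.mem_span a
    have h := Submodule.mem_map_of_mem (f := lsingle (R := ℂ) g) h
    rw [Submodule.map_span] at h
    refine Submodule.span_le.2 ?_ h
    rintro _ ⟨_, ⟨w, rfl⟩, rfl⟩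
    refine le_iSup (homog Γ) (FreeMonoid.length w) ?_
    refine single_mem_homog g ?_
    rw [range_ι_pow_eq_span b]
    refine Submodule.subset_span ⟨FreeMonoid.toList w, rfl, ?_⟩
    exact tensorAlgebra_basis_apply b (FreeMonoid.toList w)
  | add x y hx hy => exact add_mem hx hy

end

section

open SkewMonoidAlgebra

variable {V : Type*} [AddCommGroup V] [Module ℂ V] {Γ : Subgroup (V ≃ₗ[ℂ] V)}

/-! ### The canonical homomorphism on homogeneous elements -/

variable (κ : V →ₗ[ℂ] V →ₗ[ℂ] MonoidAlgebra ℂ Γ)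

lemma toH_mem_step {n : ℕ} {z : TensorSmash Γ} (hz : z ∈ homog Γ n) :
    toH κ z ∈ (filtration κ).step n :=
  ⟨z, homog_le_degLE le_rfl hz, rfl⟩

lemma toSym_vec (x : V) :
    toSym Γ (vec Γ x) = single 1 (SymmetricAlgebra.ι ℂ V x) := by
  rw [vec_apply, toSym_single]; rfl

lemma toSym_of (g : Γ) : toSym Γ (of _ Γ g) = of _ Γ g := by
  rw [of_apply, toSym_single, map_one, of_apply]

/-- On homogeneous elements the canonical homomorphism takes the symbol. -/
lemma canonicalHom_toSym {n : ℕ} {z : TensorSmash Γ} (hz : z ∈ homog Γ n) :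
    canonicalHom κ (toSym Γ z) = (filtration κ).symbol n ⟨toH κ z, toH_mem_step κ hz⟩ := by
  let b := Module.Basis.ofVectorSpace ℂ V
  suffices h : ∃ h, canonicalHom κ (toSym Γ z) = (filtration κ).symbol n ⟨toH κ z, h⟩ from
    h.choose_spec
  rw [homog_eq_span b] at hz
  induction hz using Submodule.span_induction with
  | mem z hz =>
    obtain ⟨w, g, rfl, rfl⟩ := hz
    have hmem : toH κ (word Γ b w * of _ Γ g) ∈ (filtration κ).step w.length := by
      refine toH_mem_step κ ?_
      have h := mul_mem_homog (word_mem_homog b w) (of_mem_homog g)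
      rwa [add_zero] at h
    refine ⟨hmem, ?_⟩
    induction w with
    | nil =>
      have h : canonicalHom κ (toSym Γ (word Γ b [] * of _ Γ g)) = grGrp κ g := by
        rw [word_nil, one_mul, toSym_of, canonicalHom_of]
      rw [h]
      exact AlgFiltration.symbol_congr _ rfl _ _ (by simp)
    | cons i w ih =>
      have hmem' : toH κ (word Γ b w * of _ Γ g) ∈ (filtration κ).step w.length := by
        refine toH_mem_step κ ?_
        have h := mul_mem_homog (word_mem_homog b w) (of_mem_homog g)
        rwa [add_zero] at h
      have h : canonicalHom κ (toSym Γ (word Γ b (i :: w) * of _ Γ g)) =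
          grVec κ (b i) * (filtration κ).symbol _ ⟨_, hmem'⟩ := by
        rw [word_cons, mul_assoc, map_mul, map_mul, ih hmem', toSym_vec, canonicalHom_ι]
      rw [h]
      refine (AlgFiltration.symbol_mul _ _ _).trans ?_
      refine AlgFiltration.symbol_congr _ (by simp [add_comm]) _ _ ?_
      change toH κ (vec Γ (b i)) * toH κ (word Γ b w * of _ Γ g) =
        toH κ (word Γ b (i :: w) * of _ Γ g)
      rw [← map_mul (toH κ), word_cons, mul_assoc]
  | zero =>
    have h : toH κ 0 = 0 := map_zero _
    refine ⟨h ▸ zero_mem _, ?_⟩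
    rw [map_zero, map_zero, ← map_zero ((filtration κ).symbol n)]
    exact AlgFiltration.symbol_congr _ rfl _ _ h.symm
  | add x y _ _ hx hy =>
    obtain ⟨hx', hx⟩ := hx
    obtain ⟨hy', hy⟩ := hy
    have h : toH κ (x + y) = toH κ x + toH κ y := map_add _ _ _
    refine ⟨h ▸ add_mem hx' hy', ?_⟩
    rw [map_add, map_add, hx, hy, ← map_add]
    exact AlgFiltration.symbol_congr _ rfl _ _ h.symm
  | smul c x _ hx =>
    obtain ⟨hx', hx⟩ := hx
    have h : toH κ (c • x) = c • toH κ x := map_smul _ _ _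
    refine ⟨h ▸ Submodule.smul_mem _ c hx', ?_⟩
    rw [map_smul, map_smul, hx, ← map_smul]
    exact AlgFiltration.symbol_congr _ rfl _ _ h.symm

lemma mem_prev_iff {n : ℕ} {a : H κ} :
    a ∈ (filtration κ).prev n ↔ ∃ z ∈ ⨆ i < n, homog Γ i, toH κ z = a := by
  cases n with
  | zero =>
    simp only [AlgFiltration.prev, not_lt_zero, iSup_false, iSup_bot, Submodule.mem_bot,
      exists_eq_left]
    rw [map_zero (toH κ), eq_comm]
  | succ n =>
    have h : (⨆ i < n + 1, homog Γ i) = degLE Γ n := by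
      rw [degLE_eq_iSup]
      simp only [Nat.lt_succ_iff]
    rw [h]
    exact Iff.rfl

lemma canonicalHom_surjective : Function.Surjective (canonicalHom κ) := by
  have key : ∀ (n : ℕ), ∀ z ∈ degLE Γ n, ∃ h : toH κ z ∈ (filtration κ).step n,
      (filtration κ).symbol n ⟨toH κ z, h⟩ ∈ (canonicalHom κ).range := by
    intro n z hz
    rw [degLE] at hz
    induction hz using Submodule.span_induction with
    | mem z hz =>
      obtain ⟨g, i, a, hi, ha, rfl⟩ := hz
      have hmem := single_mem_homog g ha
      rcases hi.eq_or_lt with rfl | hi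
      · exact ⟨_, _, canonicalHom_toSym κ hmem⟩
      · refine ⟨⟨_, homog_le_degLE hi.le hmem, rfl⟩, ?_⟩
        rw [AlgFiltration.symbol_eq_of_sub_mem (filtration κ) _ 0, map_zero]
        · exact zero_mem _
        · rw [Submodule.coe_zero, sub_zero, mem_prev_iff]
          exact ⟨_, Submodule.mem_iSup_of_mem i (Submodule.mem_iSup_of_mem hi hmem), rfl⟩
    | zero =>
      have h : toH κ 0 = 0 := map_zero _
      refine ⟨h ▸ zero_mem _, ?_⟩
      have := zero_mem (canonicalHom κ).range
      rw [← map_zero ((filtration κ).symbol n)] at this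
      convert this
      exact h
    | add x y _ _ hx hy =>
      obtain ⟨hx', hx⟩ := hx
      obtain ⟨hy', hy⟩ := hy
      have h : toH κ (x + y) = toH κ x + toH κ y := map_add _ _ _
      refine ⟨h ▸ add_mem hx' hy', ?_⟩
      have := add_mem hx hy
      rw [← map_add] at this
      convert this
      exact h
    | smul c x _ hx =>
      obtain ⟨hx', hx⟩ := hx
      have h : toH κ (c • x) = c • toH κ x := map_smul _ _ _
      refine ⟨h ▸ Submodule.smul_mem _ c hx', ?_⟩
      have := (canonicalHom κ).range.smul_mem hx c
      rw [← map_smul] at this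
      convert this
      exact h
  intro y
  change y ∈ (canonicalHom κ).range
  induction y using DirectSum.induction_on with
  | zero => exact zero_mem _
  | of n a =>
    obtain ⟨a, rfl⟩ := AlgFiltration.toPiece_surjective n a
    obtain ⟨a, z, hz, rfl⟩ := a
    exact (key n z hz).choose_spec
  | add x y hx hy => exact add_mem hx hy

/-- The PBW property says that a homogeneous element of `TV # Γ` whose image in `H_κ` is congruent
to an element of lower degree has zero image in `SV # Γ`. -/
theorem pbwProperty_iff :
    PBWProperty κ ↔
      ∀ (n : ℕ), ∀ z ∈ homog Γ n, toH κ z ∈ (filtration κ).prev n → toSym Γ z = 0 := by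
  constructor
  · intro h n z hz hz'
    refine h.1 ?_
    rw [canonicalHom_toSym κ hz, map_zero,
      AlgFiltration.symbol_eq_of_sub_mem (filtration κ) _ 0, map_zero]
    rwa [Submodule.coe_zero, sub_zero]
  · intro h
    refine ⟨(injective_iff_map_eq_zero _).2 fun s hs => ?_, canonicalHom_surjective κ⟩
    obtain ⟨z, rfl⟩ := toSym_surjective s
    have hz : z ∈ ⨆ n, homog Γ n := iSup_homog (Γ := Γ) ▸ Submodule.mem_top
    obtain ⟨f, hf, rfl⟩ := (Submodule.mem_iSup_iff_exists_finsupp _ _).1 hz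
    rw [Finsupp.sum, _root_.map_sum] at hs ⊢
    refine Finset.sum_eq_zero fun n hn => h n _ (hf n) ?_
    rw [_root_.map_sum, Finset.sum_congr rfl fun i _ => canonicalHom_toSym κ (hf i)] at hs
    refine (AlgFiltration.toPiece_eq_zero (x := ⟨toH κ (f n), toH_mem_step κ (hf n)⟩)).1 ?_
    have h' := congrArg (DirectSum.component ℂ ℕ (filtration κ).Piece n) hs
    rw [_root_.map_sum, map_zero, Finset.sum_eq_single n] at h'
    · rwa [AlgFiltration.symbol, LinearMap.comp_apply, DirectSum.component.lof_self] at h'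
    · intro i _ hi
      rw [AlgFiltration.symbol, LinearMap.comp_apply, DirectSum.component.of, dif_neg hi]
    · exact fun h => absurd hn h

end

section

open SkewMonoidAlgebra

variable {V : Type*} [AddCommGroup V] [Module ℂ V] {Γ : Subgroup (V ≃ₗ[ℂ] V)}

/-! ### The PBW property implies equivariance and the Jacobi identity -/

variable (κ : V →ₗ[ℂ] V →ₗ[ℂ] MonoidAlgebra ℂ Γ)

/-- Equivariance of `κ` for the conjugation action of `Γ` on `ℂΓ`. -/
def Equivariant : Prop :=
  ∀ (g : Γ) (x y : V), MonoidAlgebra.of ℂ Γ g * κ x y =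
    κ ((g : V ≃ₗ[ℂ] V) x) ((g : V ≃ₗ[ℂ] V) y) * MonoidAlgebra.of ℂ Γ g

/-- The Jacobi identity `[κ(x, y), z] + [κ(y, z), x] + [κ(z, x), y] = 0` in `TV # Γ`, written out
for the coefficient of each `g ∈ Γ`. -/
def Jacobi : Prop :=
  ∀ (g : Γ) (x y z : V),
    (κ x y).coeff g • ((g : V ≃ₗ[ℂ] V) z - z) + (κ y z).coeff g • ((g : V ≃ₗ[ℂ] V) x - x) +
      (κ z x).coeff g • ((g : V ≃ₗ[ℂ] V) y - y) = 0

lemma coeff_grp (a : MonoidAlgebra ℂ Γ) (g : Γ) :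
    (grp Γ a).coeff g = algebraMap ℂ _ (a.coeff g) := by
  classical
  induction a using MonoidAlgebra.induction_on with
  | of h =>
    rw [grp_of, of_apply, coeff_single_apply, MonoidAlgebra.of_apply, MonoidAlgebra.coeff_single,
      Finsupp.single_apply]
    split_ifs <;> simp
  | add a b ha hb => simp [ha, hb]
  | smul r a ha => rw [map_smul, coeff_smul, Finsupp.smul_apply, ha]; simp [Algebra.smul_def]

lemma coeff_grp_commutator (a : MonoidAlgebra ℂ Γ) (z : V) (g : Γ) :
    (grp Γ a * vec Γ z - vec Γ z * grp Γ a).coeff g =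
      TensorAlgebra.ι ℂ (a.coeff g • ((g : V ≃ₗ[ℂ] V) z - z)) := by
  classical
  have hsub : ∀ p q : TensorSmash Γ, (p - q).coeff g = p.coeff g - q.coeff g := by
    intro p q
    rw [eq_sub_iff_add_eq, ← Finsupp.add_apply, ← coeff_add, sub_add_cancel]
  induction a using MonoidAlgebra.induction_on with
  | of h =>
    rw [grp_of, of_mul_vec, ← sub_mul, ← map_sub, of_apply, vec_apply, single_mul_single,
      coeff_single_apply, MonoidAlgebra.of_apply, MonoidAlgebra.coeff_single, Finsupp.single_apply]
    simp only [one_mul]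
    split_ifs with hh
    · subst hh; simp
    · simp
  | add a b ha hb =>
    rw [hsub] at ha hb ⊢
    simp only [map_add, add_mul, mul_add, MonoidAlgebra.coeff_add, Finsupp.add_apply, coeff_add,
      add_smul, ← ha, ← hb]
    abel
  | smul r a ha =>
    rw [map_smul, smul_mul_assoc, mul_smul_comm, ← smul_sub, coeff_smul, Finsupp.smul_apply, ha,
      ← map_smul, MonoidAlgebra.coeff_smul, Finsupp.smul_apply, smul_assoc]

variable {κ}

lemma jacobi_grp (hJ : Jacobi κ) (x y z : V) :
    (grp Γ (κ x y) * vec Γ z - vec Γ z * grp Γ (κ x y)) +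
      (grp Γ (κ y z) * vec Γ x - vec Γ x * grp Γ (κ y z)) +
      (grp Γ (κ z x) * vec Γ y - vec Γ y * grp Γ (κ z x)) = 0 := by
  ext g
  rw [coeff_add, coeff_add, Finsupp.add_apply, Finsupp.add_apply, coeff_grp_commutator,
    coeff_grp_commutator, coeff_grp_commutator, ← map_add, ← map_add, hJ g x y z, map_zero]
  rfl

lemma symmetricAlgebra_ι_injective : Function.Injective (SymmetricAlgebra.ι ℂ V) := by
  rw [injective_iff_map_eq_zero]
  intro x hx
  rw [← Module.forall_dual_apply_eq_zero_iff ℂ]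
  intro f
  rw [← SymmetricAlgebra.lift_ι_apply f x, hx, map_zero]

lemma PBWProperty.toSym_eq_zero (h : PBWProperty κ) {n : ℕ} {z : TensorSmash Γ}
    (hz : z ∈ homog Γ n) (hz' : toH κ z = 0) : toSym Γ z = 0 :=
  (pbwProperty_iff κ).1 h n z hz (hz' ▸ zero_mem _)

lemma PBWProperty.equivariant (h : PBWProperty κ) : Equivariant κ := by
  intro g x y
  rw [← sub_eq_zero]
  set d := MonoidAlgebra.of ℂ Γ g * κ x y -
    κ ((g : V ≃ₗ[ℂ] V) x) ((g : V ≃ₗ[ℂ] V) y) * MonoidAlgebra.of ℂ Γ g with hd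
  have hH : toH κ (grp Γ d) = 0 := by
    rw [hd, map_sub, map_mul, map_mul, grp_of, map_sub (toH κ), map_mul (toH κ), map_mul (toH κ),
      ← toH_rel, ← toH_rel, sub_eq_zero, ← map_mul (toH κ), ← map_mul (toH κ), ← map_mul (toH κ),
      ← map_mul (toH κ), ← map_sub (toH κ), ← map_sub (toH κ), ← map_mul (toH κ),
      ← map_mul (toH κ)]
    congr 1
    simp only [mul_sub, sub_mul, ← mul_assoc, of_mul_vec]
    simp only [mul_assoc, of_mul_vec]
  have hs := h.toSym_eq_zero (grp_mem_homog d) hH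
  ext k
  have hk := coeff_toSym (grp Γ d) k
  rw [hs, coeff_grp, AlgHom.commutes, coeff_zero, Finsupp.zero_apply, eq_comm,
    SymmetricAlgebra.algebraMap_eq_zero_iff] at hk
  rw [hk]; rfl

lemma commutator_jacobi {R : Type*} [Ring R] (a b c : R) :
    ((a * b - b * a) * c - c * (a * b - b * a)) + ((b * c - c * b) * a - a * (b * c - c * b)) +
      ((c * a - a * c) * b - b * (c * a - a * c)) = 0 := by
  noncomm_ring

lemma PBWProperty.jacobi (h : PBWProperty κ) : Jacobi κ := by
  intro g x y z
  set j := (grp Γ (κ x y) * vec Γ z - vec Γ z * grp Γ (κ x y)) +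
      (grp Γ (κ y z) * vec Γ x - vec Γ x * grp Γ (κ y z)) +
      (grp Γ (κ z x) * vec Γ y - vec Γ y * grp Γ (κ z x)) with hj
  have hmem : ∀ x y z : V, grp Γ (κ x y) * vec Γ z - vec Γ z * grp Γ (κ x y) ∈ homog Γ 1 :=
    fun x y z => by
      have h1 := mul_mem_homog (grp_mem_homog (κ x y)) (vec_mem_homog z)
      have h2 := mul_mem_homog (vec_mem_homog z) (grp_mem_homog (κ x y))
      rw [zero_add] at h1
      rw [add_zero] at h2
      exact sub_mem h1 h2
  have hjm : j ∈ homog Γ 1 := add_mem (add_mem (hmem x y z) (hmem y z x)) (hmem z x y)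
  have hH : toH κ j = 0 := by
    simp only [hj, map_add (toH κ), map_sub (toH κ), map_mul (toH κ), ← toH_rel]
    exact commutator_jacobi (R := H κ) (toH κ (vec Γ x)) (toH κ (vec Γ y)) (toH κ (vec Γ z))
  have hs := h.toSym_eq_zero hjm hH
  have hk := coeff_toSym j g
  rw [hs, hj, coeff_add, coeff_add, Finsupp.add_apply, Finsupp.add_apply, coeff_grp_commutator,
    coeff_grp_commutator, coeff_grp_commutator, ← map_add, ← map_add] at hk
  have hk' : SymmetricAlgebra.ι ℂ V ((κ x y).coeff g • ((g : V ≃ₗ[ℂ] V) z - z) +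
      (κ y z).coeff g • ((g : V ≃ₗ[ℂ] V) x - x) +
      (κ z x).coeff g • ((g : V ≃ₗ[ℂ] V) y - y)) = 0 := by
    exact hk.symm
  exact symmetricAlgebra_ι_injective (hk'.trans (map_zero _).symm)

end

section

open SkewMonoidAlgebra

variable {V : Type*} [AddCommGroup V] [Module ℂ V] {Γ : Subgroup (V ≃ₗ[ℂ] V)}

/-! ### The filtration of `SV # Γ` by degree -/

section Degree

variable {ι : Type*} (b : Module.Basis ι ℂ V)

lemma toSym_mul_of (z : TensorSmash Γ) (g : Γ) :
    toSym Γ (z * of _ Γ g) = toSym Γ z * of _ Γ g := by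
  rw [map_mul, toSym_of]

lemma coeff_mul_of (s : SymSmash Γ) (g h : Γ) : (s * of _ Γ g).coeff h = s.coeff (h * g⁻¹) := by
  rw [of_apply, coeff_mul_single, smul_one, mul_one]

variable (Γ) in
/-- The elements of `SV # Γ` all of whose coefficients have degree less than `n`. -/
def symLT (n : ℕ) : Submodule ℂ (SymSmash Γ) where
  carrier := {s | ∀ (g : Γ) (k : ℕ), n ≤ k → MvPolynomial.homogeneousComponent k
    (SymmetricAlgebra.equivMvPolynomial b (s.coeff g)) = 0}
  zero_mem' g k _ := by simp
  add_mem' {s t} hs ht g k hk := by simp [hs g k hk, ht g k hk]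
  smul_mem' c s hs g k hk := by simp [hs g k hk]

lemma symLT_mono : Monotone (symLT Γ b) := fun _ _ hmn _ hs g k hk => hs g k (hmn.trans hk)

lemma mul_of_mem_symLT {n : ℕ} {s : SymSmash Γ} (hs : s ∈ symLT Γ b n) (g : Γ) :
    s * of _ Γ g ∈ symLT Γ b n := by
  intro h k hk
  rw [coeff_mul_of]
  exact hs _ k hk

lemma isHomogeneous_coeff_toSym {n : ℕ} {z : TensorSmash Γ} (hz : z ∈ homog Γ n) (g : Γ) :
    (SymmetricAlgebra.equivMvPolynomial b ((toSym Γ z).coeff g)).IsHomogeneous n := by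
  classical
  rw [homog_eq_span b] at hz
  induction hz using Submodule.span_induction with
  | mem z hz =>
    obtain ⟨w, h, rfl, rfl⟩ := hz
    rw [coeff_toSym, word_eq_single, of_apply, single_mul_single, coeff_single_apply]
    split_ifs
    · rw [smul_one, mul_one]
      induction w with
      | nil => simpa using MvPolynomial.isHomogeneous_one _ _
      | cons i w ih =>
        have hi : SymmetricAlgebra.algHom ℂ V (TensorAlgebra.ι ℂ (b i)) =
          SymmetricAlgebra.ι ℂ V (b i) := rfl
        rw [List.map_cons, List.prod_cons, map_mul, map_mul, hi,
          SymmetricAlgebra.equivMvPolynomial_ι_apply, List.length_cons, add_comm]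
        exact (MvPolynomial.isHomogeneous_X _ _).mul ih
    · simpa using MvPolynomial.isHomogeneous_zero _ _ _
  | zero => simpa using MvPolynomial.isHomogeneous_zero _ _ _
  | add x y _ _ hx hy => simpa using hx.add hy
  | smul c x _ hx =>
    rw [map_smul, coeff_smul, Finsupp.smul_apply, map_smul]
    exact (MvPolynomial.homogeneousSubmodule ι ℂ n).smul_mem c hx

lemma toSym_mem_symLT {m n : ℕ} (hmn : m < n) {z : TensorSmash Γ} (hz : z ∈ homog Γ m) :
    toSym Γ z ∈ symLT Γ b n := by
  intro g k hk
  rw [MvPolynomial.homogeneousComponent_of_mem (isHomogeneous_coeff_toSym b hz g),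
    if_neg (by omega)]

lemma toSym_eq_zero_of_mem_symLT {n : ℕ} {z : TensorSmash Γ} (hz : z ∈ homog Γ n)
    (h : toSym Γ z ∈ symLT Γ b n) : toSym Γ z = 0 := by
  ext g
  have h' := h g n le_rfl
  rw [MvPolynomial.homogeneousComponent_of_mem (isHomogeneous_coeff_toSym b hz g),
    if_pos rfl] at h'
  rw [(map_eq_zero_iff _ (SymmetricAlgebra.equivMvPolynomial b).injective).1 h']
  rfl

end Degree

/-! ### Normal forms for `H_κ` -/

section NormalForm

variable {ι : Type*} (b : Module.Basis ι ℂ V)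

/-- The right `ℂΓ`-linear map `TV # Γ → SV # Γ` with prescribed values on words. -/
def ofWords (f : List ι → SymSmash Γ) : TensorSmash Γ →ₗ[ℂ] SymSmash Γ :=
  Finsupp.lsum ℂ (fun g : Γ =>
    (Algebra.lmul ℂ (SymSmash Γ)).toLinearMap.flip (of (SymmetricAlgebra ℂ V) Γ g) ∘ₗ
    b.tensorAlgebra.constr ℂ fun w => f (FreeMonoid.toList w)) ∘ₗ
      (coeffLinearEquiv (S := ℂ)).toLinearMap

lemma ofWords_single (f : List ι → SymSmash Γ) (g : Γ) (a : TensorAlgebra ℂ V) :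
    ofWords b f (single g a) =
      b.tensorAlgebra.constr ℂ (fun w => f (FreeMonoid.toList w)) a * of _ Γ g := by
  change Finsupp.lsum ℂ _ (Finsupp.single g a) = _
  rw [Finsupp.lsum_single]
  rfl

lemma ofWords_word (f : List ι → SymSmash Γ) (w : List ι) : ofWords b f (word Γ b w) = f w := by
  rw [word_eq_single, ofWords_single, map_one, mul_one, ← tensorAlgebra_basis_apply,
    Module.Basis.constr_basis]
  rfl

lemma ofWords_mul_of (f : List ι → SymSmash Γ) (z : TensorSmash Γ) (g : Γ) :
    ofWords b f (z * of _ Γ g) = ofWords b f z * of _ Γ g := by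
  induction z using SkewMonoidAlgebra.induction_on with
  | zero => simp
  | single h a =>
    rw [of_apply, single_mul_single, smul_one, mul_one, ofWords_single, ofWords_single, map_mul,
      mul_assoc]
  | add x y hx hy => rw [add_mul, map_add, map_add, hx, hy, add_mul]

lemma eq_of_eq_on_words {Φ Ψ : TensorSmash Γ →ₗ[ℂ] SymSmash Γ}
    (hΦ : ∀ z g, Φ (z * of _ Γ g) = Φ z * of _ Γ g) (hΨ : ∀ z g, Ψ (z * of _ Γ g) = Ψ z * of _ Γ g)
    {n : ℕ} (h : ∀ w : List ι, w.length = n → Φ (word Γ b w) = Ψ (word Γ b w))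
    {z : TensorSmash Γ} (hz : z ∈ homog Γ n) : Φ z = Ψ z := by
  rw [homog_eq_span b] at hz
  refine LinearMap.eqOn_span (f := Φ) (g := Ψ) ?_ hz
  rintro _ ⟨w, g, hw, rfl⟩
  rw [hΦ, hΨ, h w hw]

variable (κ : V →ₗ[ℂ] V →ₗ[ℂ] MonoidAlgebra ℂ Γ)

/-- The value `Φ (u κ(x, y) v)` by which `Φ (u x y v)` and `Φ (u y x v)` have to differ if `Φ` is to
factor through `H_κ`. -/
def swapCost (Φ : TensorSmash Γ →ₗ[ℂ] SymSmash Γ) (u : List ι) (x y : ι) (v : List ι) :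
    SymSmash Γ :=
  Φ (word Γ b u * grp Γ (κ (b x) (b y)) * word Γ b v)

lemma swapCost_mem_homog (u : List ι) (x y : V) (v : List ι) :
    word Γ b u * grp Γ (κ x y) * word Γ b v ∈ homog Γ (u.length + v.length) :=
  mul_mem_homog (i := u.length) (mul_mem_homog (j := 0) (word_mem_homog b u) (grp_mem_homog _))
    (word_mem_homog b v)

variable [LinearOrder ι]

/-- The normal form map in degree `n`: a word is sent to the corresponding monomial, plus the cost
of sorting the word, which involves the normal form map in degree `n - 2`. -/
def normalFormAux : ℕ → (TensorSmash Γ →ₗ[ℂ] SymSmash Γ)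
  | 0 => (toSym Γ).toLinearMap
  | 1 => (toSym Γ).toLinearMap
  | n + 2 => ofWords b fun w =>
      toSym Γ (word Γ b w) + sortCost (swapCost b κ (normalFormAux n)) [] w

/-- The normal form map `TV # Γ → SV # Γ`. It vanishes on the ideal of relations of `H_κ` if `κ` is
equivariant and satisfies the Jacobi identity. -/
def normalForm : TensorSmash Γ →ₗ[ℂ] SymSmash Γ :=
  ofWords b fun w => normalFormAux b κ w.length (word Γ b w)

lemma normalFormAux_mul_of (n : ℕ) (z : TensorSmash Γ) (g : Γ) :
    normalFormAux b κ n (z * of _ Γ g) = normalFormAux b κ n z * of _ Γ g := by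
  match n with
  | 0 => exact toSym_mul_of z g
  | 1 => exact toSym_mul_of z g
  | n + 2 => exact ofWords_mul_of b _ z g

lemma normalForm_mul_of (z : TensorSmash Γ) (g : Γ) :
    normalForm b κ (z * of _ Γ g) = normalForm b κ z * of _ Γ g :=
  ofWords_mul_of b _ z g

lemma normalForm_eq_aux {n : ℕ} {z : TensorSmash Γ} (hz : z ∈ homog Γ n) :
    normalForm b κ z = normalFormAux b κ n z := by
  refine eq_of_eq_on_words b (normalForm_mul_of b κ) (normalFormAux_mul_of b κ n) ?_ hz
  rintro w rfl
  exact ofWords_word b _ w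

lemma normalForm_word (w : List ι) :
    normalForm b κ (word Γ b w) =
      toSym Γ (word Γ b w) + sortCost (swapCost b κ (normalForm b κ)) [] w := by
  rw [normalForm_eq_aux b κ (word_mem_homog b w)]
  match w with
  | [] => simp [normalFormAux, sortCost]
  | [x] => simp [normalFormAux, sortCost, insertCost]
  | x :: y :: w =>
    refine (ofWords_word b _ _).trans ?_
    congr 1
    refine sortCost_congr (n := w.length + 2) ?_ _ _ (by simp)
    intro u x y v hn
    refine (normalForm_eq_aux b κ ?_).symm
    have h := swapCost_mem_homog b κ u (b x) (b y) v
    rwa [show u.length + v.length = w.length by omega] at h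

lemma normalForm_sub_toSym_mem {n : ℕ} {z : TensorSmash Γ} (hz : z ∈ homog Γ n) :
    normalForm b κ z - toSym Γ z ∈ symLT Γ b n := by
  induction n using Nat.strong_induction_on generalizing z with
  | _ n ih =>
  rw [homog_eq_span b] at hz
  induction hz using Submodule.span_induction with
  | mem z hz =>
    obtain ⟨w, g, rfl, rfl⟩ := hz
    rw [normalForm_mul_of, toSym_mul_of, ← sub_mul]
    refine mul_of_mem_symLT b ?_ g
    rw [normalForm_word, add_sub_cancel_left]
    refine sortCost_mem (S := (symLT Γ b w.length).toAddSubgroup) (n := w.length) ?_ _ _ (by simp)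
    intro u x y v hn
    have h := swapCost_mem_homog b κ u (b x) (b y) v
    have h1 := symLT_mono b (by omega : u.length + v.length ≤ w.length) (ih _ (by omega) h)
    have h2 := toSym_mem_symLT b (by omega : u.length + v.length < w.length) h
    have h3 := add_mem h1 h2
    rwa [sub_add_cancel] at h3
  | zero => simp
  | add x y _ _ hx hy =>
    rw [map_add, map_add, add_sub_add_comm]
    exact add_mem hx hy
  | smul c x _ hx =>
    rw [map_smul, map_smul, ← smul_sub]
    exact Submodule.smul_mem _ c hx

end NormalForm

end

section

open SkewMonoidAlgebra

variable {V : Type*} [AddCommGroup V] [Module ℂ V] {Γ : Subgroup (V ≃ₗ[ℂ] V)}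

/-! ### Equivariance and the Jacobi identity imply the PBW property -/

variable (κ : V →ₗ[ℂ] V →ₗ[ℂ] MonoidAlgebra ℂ Γ)

/-- The relation `x ⊗ y - y ⊗ x - κ(x, y)`, bilinear in `x` and `y`. -/
def relator : V →ₗ[ℂ] V →ₗ[ℂ] TensorSmash Γ :=
  LinearMap.mk₂ ℂ (fun x y => vec Γ x * vec Γ y - vec Γ y * vec Γ x - grp Γ (κ x y))
    (fun x x' y => by simp only [map_add, LinearMap.add_apply, add_mul, mul_add]; abel)
    (fun c x y => by
      simp only [map_smul, LinearMap.smul_apply, smul_mul_assoc, mul_smul_comm, smul_sub])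
    (fun x y y' => by simp only [map_add, add_mul, mul_add]; abel)
    (fun c x y => by simp only [map_smul, smul_mul_assoc, mul_smul_comm, smul_sub])

lemma relator_apply (x y : V) :
    relator κ x y = vec Γ x * vec Γ y - vec Γ y * vec Γ x - grp Γ (κ x y) := rfl

variable {κ}

lemma of_mul_relator (hE : Equivariant κ) (g : Γ) (x y : V) :
    of _ Γ g * relator κ x y =
      relator κ ((g : V ≃ₗ[ℂ] V) x) ((g : V ≃ₗ[ℂ] V) y) * of _ Γ g := by
  have h := congrArg (grp Γ) (hE g x y)
  rw [map_mul, map_mul, grp_of] at h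
  simp only [relator_apply, mul_sub, sub_mul, ← mul_assoc, of_mul_vec, h]
  simp only [mul_assoc, of_mul_vec]

variable {ι : Type*} (b : Module.Basis ι ℂ V)

/-- By equivariance and right `ℂΓ`-linearity it suffices to test the vanishing of `Φ` on the ideal
of relations on words in a basis. -/
lemma map_mul_relator_mul_eq_zero (hE : Equivariant κ) {Φ : TensorSmash Γ →ₗ[ℂ] SymSmash Γ}
    (hΦ : ∀ z g, Φ (z * of _ Γ g) = Φ z * of _ Γ g) {p q : ℕ}
    (h : ∀ (u v : List ι) (i j : ι), u.length = p → v.length = q →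
      Φ (word Γ b u * relator κ (b i) (b j) * word Γ b v) = 0)
    {P Q : TensorSmash Γ} (hP : P ∈ homog Γ p) (hQ : Q ∈ homog Γ q) (x y : V) :
    Φ (P * relator κ x y * Q) = 0 := by
  -- the case that `P` is a word
  have h1 : ∀ (u : List ι), u.length = p → ∀ Q ∈ homog Γ q, ∀ x y : V,
      Φ (word Γ b u * relator κ x y * Q) = 0 := by
    intro u hu Q hQ x y
    rw [homog_eq_span b] at hQ
    induction hQ using Submodule.span_induction with
    | mem Q hQ =>
      obtain ⟨v, g, hv, rfl⟩ := hQ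
      rw [← mul_assoc, hΦ]
      have h2 : (relator κ).compr₂ (Φ ∘ₗ
          (Algebra.lmul ℂ (TensorSmash Γ)).toLinearMap.flip (word Γ b v) ∘ₗ
          (Algebra.lmul ℂ (TensorSmash Γ)).toLinearMap (word Γ b u)) = 0 :=
        b.ext fun i => b.ext fun j => h u v i j hu hv
      have h3 : Φ (word Γ b u * relator κ x y * word Γ b v) = 0 :=
        LinearMap.congr_fun₂ h2 x y
      rw [h3, zero_mul]
    | zero => rw [mul_zero, map_zero]
    | add Q Q' _ _ hQ hQ' => rw [mul_add, map_add, hQ, hQ', add_zero]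
    | smul c Q _ hQ => rw [mul_smul_comm, map_smul, hQ, smul_zero]
  rw [homog_eq_span b] at hP
  induction hP using Submodule.span_induction with
  | mem P hP =>
    obtain ⟨u, g, hu, rfl⟩ := hP
    rw [mul_assoc (word Γ b u), of_mul_relator hE, ← mul_assoc, mul_assoc]
    refine h1 u hu _ ?_ _ _
    have h2 := mul_mem_homog (of_mem_homog g) hQ
    rwa [zero_add] at h2
  | zero => rw [zero_mul, zero_mul, map_zero]
  | add P P' _ _ hP hP' => rw [add_mul, add_mul, map_add, hP, hP', add_zero]
  | smul c P _ hP => rw [smul_mul_assoc, smul_mul_assoc, map_smul, hP, smul_zero]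

lemma toSym_vec_mul_vec_comm (x y : V) :
    toSym Γ (vec Γ x * vec Γ y) = toSym Γ (vec Γ y * vec Γ x) := by
  rw [map_mul, map_mul, toSym_vec, toSym_vec, single_mul_single, single_mul_single, one_smul,
    one_smul, mul_comm (SymmetricAlgebra.ι ℂ V x)]

lemma braidRelation_swapCost (hκ : ∀ x y : V, κ x y = -κ y x) (hJ : Jacobi κ)
    (Φ : TensorSmash Γ →ₗ[ℂ] SymSmash Γ) : BraidRelation (swapCost b κ Φ) := by
  intro u x y z w
  have h := congrArg (fun t => Φ (word Γ b u * t * word Γ b w)) (jacobi_grp hJ (b x) (b y) (b z))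
  have hzx : κ (b z) (b x) = 0 - κ (b x) (b z) := by rw [hκ, zero_sub]
  simp only [hzx, mul_add, add_mul, mul_sub, sub_mul,
    map_add, map_sub, mul_zero, zero_mul, map_zero, mul_assoc] at h
  simp only [swapCost, word_append, word_cons, word_nil, mul_one, mul_assoc]
  rw [← sub_eq_zero, ← h]
  abel

lemma farCommuting_swapCost {n : ℕ} {Φ : TensorSmash Γ →ₗ[ℂ] SymSmash Γ}
    (h : ∀ p q : ℕ, p + q + 4 = n → ∀ P ∈ homog Γ p, ∀ Q ∈ homog Γ q, ∀ x y : V,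
      Φ (P * relator κ x y * Q) = 0) : FarCommuting n (swapCost b κ Φ) := by
  intro u x y v a d w hn
  have hmem : ∀ x y : V, word Γ b u * grp Γ (κ x y) * word Γ b v ∈ homog Γ (u.length + v.length) :=
    fun x y => swapCost_mem_homog b κ u x y v
  have hmem' : word Γ b v * grp Γ (κ (b a) (b d)) * word Γ b w ∈
      homog Γ (v.length + w.length) := swapCost_mem_homog b κ v _ _ w
  have h1 := h (u.length + v.length) w.length (by omega) _ (hmem (b x) (b y)) _
    (word_mem_homog b w) (b a) (b d)
  have h2 := h u.length (v.length + w.length) (by omega) _ (word_mem_homog b u) _ hmem'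
    (b x) (b y)
  simp only [relator_apply, mul_sub, sub_mul, map_sub, mul_assoc] at h1 h2
  simp only [swapCost, word_append, word_cons, mul_assoc]
  rw [← sub_eq_zero, ← sub_zero (0 : SymSmash Γ)]
  nth_rw 1 [← h1]
  rw [← h2]
  abel

variable [LinearOrder ι]

lemma normalForm_mul_relator_mul (hκ : ∀ x y : V, κ x y = -κ y x) (hE : Equivariant κ)
    (hJ : Jacobi κ) {p q : ℕ} {P Q : TensorSmash Γ} (hP : P ∈ homog Γ p) (hQ : Q ∈ homog Γ q)
    (x y : V) : normalForm b κ (P * relator κ x y * Q) = 0 := by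
  induction hn : p + q using Nat.strong_induction_on generalizing p q P Q x y with
  | _ n ih =>
  refine map_mul_relator_mul_eq_zero b hE (normalForm_mul_of b κ) ?_ hP hQ x y
  intro u v i j hu hv
  have hcomm : FarCommuting (n + 2) (swapCost b κ (normalForm b κ)) := by
    refine farCommuting_swapCost b ?_
    intro p' q' hpq P' hP' Q' hQ' x y
    exact ih (p' + q') (by omega) hP' hQ' x y rfl
  have hdiag : ∀ u x v, swapCost b κ (normalForm b κ) u x x v = 0 := by
    intro u x v
    have h : κ (b x) (b x) = 0 := by
      have := hκ (b x) (b x)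
      have h2 : (2 : ℂ) • κ (b x) (b x) = 0 := by
        rw [two_smul]
        nth_rw 1 [this]
        rw [neg_add_cancel]
      rw [← one_smul ℂ (κ (b x) (b x)), ← inv_mul_cancel₀ (two_ne_zero (α := ℂ)), mul_smul, h2,
        smul_zero]
    simp [swapCost, h]
  have hanti : ∀ u x y v, swapCost b κ (normalForm b κ) u x y v =
      -swapCost b κ (normalForm b κ) u y x v := by
    intro u x y v
    have hxy : κ (b x) (b y) = 0 - κ (b y) (b x) := by rw [hκ, zero_sub]
    rw [swapCost, hxy, map_sub, mul_sub, sub_mul, map_sub, map_zero, mul_zero, zero_mul, map_zero,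
      zero_sub]
    rfl
  have h := sortCost_sub_sortCost hdiag hanti hcomm
    (braidRelation_swapCost b hκ hJ (normalForm b κ)) [] u i j v (by simp; omega)
  have h1 := normalForm_word b κ (u ++ i :: j :: v)
  have h2 := normalForm_word b κ (u ++ j :: i :: v)
  have h3 : toSym Γ (word Γ b (u ++ i :: j :: v)) = toSym Γ (word Γ b (u ++ j :: i :: v)) := by
    simp only [word_append, word_cons]
    rw [map_mul, map_mul (toSym Γ) (word Γ b u), ← mul_assoc, ← mul_assoc, map_mul,
      map_mul (toSym Γ) (vec Γ (b j) * _), toSym_vec_mul_vec_comm]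
  rw [h3] at h1
  have h4 := congrArg₂ (· - ·) h1 h2
  simp only [add_sub_add_left_eq_sub, h] at h4
  simp only [word_append, word_cons, swapCost, List.nil_append] at h4
  simp only [relator_apply, mul_sub, sub_mul, map_sub, mul_assoc] at h4 ⊢
  rw [h4, sub_self]

lemma normalForm_eq_zero (hκ : ∀ x y : V, κ x y = -κ y x) (hE : Equivariant κ)
    (hJ : Jacobi κ) {z : TensorSmash Γ} (hz : z ∈ relIdeal κ) : normalForm b κ z = 0 := by
  let I : TwoSidedIdeal (TensorSmash Γ) := TwoSidedIdeal.mk'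
    {z | ∀ P Q, normalForm b κ (P * z * Q) = 0} (by intro P Q; simp)
    (by intro x y hx hy P Q; rw [mul_add, add_mul, map_add, hx, hy, add_zero])
    (by
      intro x hx P Q
      rw [← zero_sub, mul_sub, sub_mul, map_sub, hx, mul_zero, zero_mul, map_zero, sub_zero])
    (by intro x y hy P Q; rw [← mul_assoc P]; exact hy _ _)
    (by intro x y hx P Q; rw [← mul_assoc P, mul_assoc _ y]; exact hx _ _)
  have hI : relIdeal κ ≤ I := by
    refine TwoSidedIdeal.span_le.2 ?_
    rintro _ ⟨x, y, rfl⟩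
    change _ ∈ I
    rw [TwoSidedIdeal.mem_mk']
    intro P Q
    have hP : P ∈ ⨆ n, homog Γ n := iSup_homog (Γ := Γ) ▸ Submodule.mem_top
    have hQ : Q ∈ ⨆ n, homog Γ n := iSup_homog (Γ := Γ) ▸ Submodule.mem_top
    change normalForm b κ (P * relator κ x y * Q) = 0
    induction hP using Submodule.iSup_induction' with
    | mem p P hP =>
      induction hQ using Submodule.iSup_induction' with
      | mem q Q hQ => exact normalForm_mul_relator_mul b hκ hE hJ hP hQ x y
      | zero => rw [mul_zero, map_zero]
      | add Q Q' _ _ hQ hQ' => rw [mul_add, map_add, hQ, hQ', add_zero]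
    | zero => rw [zero_mul, zero_mul, map_zero]
    | add P P' _ _ hP hP' => rw [add_mul, add_mul, map_add, hP, hP', add_zero]
  have h := hI hz
  rw [TwoSidedIdeal.mem_mk'] at h
  simpa using h 1 1

/-- The PBW theorem: `H_κ` has the PBW property if `κ` is equivariant and satisfies the Jacobi
identity. -/
theorem pbwProperty_of_jacobi (hκ : ∀ x y : V, κ x y = -κ y x) (hE : Equivariant κ)
    (hJ : Jacobi κ) : PBWProperty κ := by
  let b := Module.Basis.ofVectorSpace ℂ V
  let : LinearOrder (Module.Basis.ofVectorSpaceIndex ℂ V) :=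
    IsWellOrder.linearOrder WellOrderingRel
  rw [pbwProperty_iff]
  intro n z hz hz'
  obtain ⟨y, hy, hyz⟩ := (mem_prev_iff κ).1 hz'
  have hzy : normalForm b κ z = normalForm b κ y := by
    rw [← sub_eq_zero, ← map_sub]
    refine normalForm_eq_zero b hκ hE hJ ?_
    rw [TwoSidedIdeal.mem_iff]
    refine (RingCon.eq _).1 ?_
    change toH κ (z - y) = 0
    rw [map_sub (toH κ), hyz, sub_self]
  have hylt : normalForm b κ y ∈ symLT Γ b n := by
    have hle : (⨆ i < n, homog Γ i) ≤ (symLT Γ b n).comap (normalForm b κ) := by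
      refine iSup₂_le fun i hi x hx => ?_
      have h1 := symLT_mono b hi.le (normalForm_sub_toSym_mem b κ hx)
      have h2 := add_mem h1 (toSym_mem_symLT b hi hx)
      rwa [sub_add_cancel] at h2
    exact hle hy
  refine toSym_eq_zero_of_mem_symLT b hz ?_
  have h := sub_mem hylt (normalForm_sub_toSym_mem b κ hz)
  rwa [← hzy, sub_sub_cancel] at h

theorem pbwProperty_iff_jacobi (hκ : ∀ x y : V, κ x y = -κ y x) :
    PBWProperty κ ↔ Equivariant κ ∧ Jacobi κ :=
  ⟨fun h => ⟨h.equivariant, h.jacobi⟩, fun h => pbwProperty_of_jacobi hκ h.1 h.2⟩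

end

section

variable {V : Type*} [AddCommGroup V] [Module ℂ V]
  {Γ : Subgroup (V ≃ₗ[ℂ] V)} {ω : LinearMap.BilinForm ℂ V}

/-! ### Invariant alternating forms on an indecomposable triple -/

lemma isSymplectic_restrict (hω : ω.IsAlt) {U : Submodule ℂ V}
    (hU : ∀ x ∈ U, (∀ y ∈ U, ω x y = 0) → x = 0) : IsSymplectic (ω.restrict U) := by
  refine ⟨fun x => hω x, fun x hx => ?_, fun y hy => ?_⟩
  · exact Subtype.ext (hU x x.2 fun y hy => hx ⟨y, hy⟩)
  · refine Subtype.ext (hU y y.2 fun x hx => ?_)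
    exact hω.isRefl _ _ (hy ⟨x, hx⟩)

/-- Every stable subspace has a stable complement. -/
lemma exists_stable_isCompl [Finite Γ] {U : Submodule ℂ V} (hUΓ : ∀ g ∈ Γ, ∀ x ∈ U, g x ∈ U) :
    ∃ W : Submodule ℂ V, (∀ g ∈ Γ, ∀ x ∈ W, g x ∈ W) ∧ IsCompl U W := by
  let ρ : Representation ℂ Γ V :=
    { toFun := fun g => ((g : V ≃ₗ[ℂ] V) : V →ₗ[ℂ] V)
      map_one' := rfl
      map_mul' := fun _ _ => rfl }
  have : NeZero (Nat.card Γ : ℂ) := ⟨Nat.cast_ne_zero.2 Nat.card_pos.ne'⟩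
  obtain ⟨W, hW⟩ := exists_isCompl (⟨U, fun g x hx => hUΓ g g.2 x hx⟩ : Subrepresentation ρ)
  refine ⟨W.toSubmodule, fun g hg x hx => W.apply_mem_toSubmodule ⟨g, hg⟩ hx, ?_⟩
  rw [isCompl_iff, disjoint_iff, codisjoint_iff] at hW ⊢
  exact ⟨congrArg Subrepresentation.toSubmodule hW.1, congrArg Subrepresentation.toSubmodule hW.2⟩

variable [FiniteDimensional ℂ V]

/-- In an indecomposable triple a stable subspace on which `ω` is nondegenerate is trivial. -/
lemma Indecomposable.eq_bot_or_eq_top (hω : IsSymplectic ω) (hΓ : Γ ≤ Sp ω)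
    (hind : Indecomposable Γ ω) {U : Submodule ℂ V} (hUΓ : ∀ g ∈ Γ, ∀ x ∈ U, g x ∈ U)
    (hU : ∀ x ∈ U, (∀ y ∈ U, ω x y = 0) → x = 0) : U = ⊥ ∨ U = ⊤ := by
  have hc : IsCompl U (ω.orthogonal U) := by
    rw [LinearMap.BilinForm.isCompl_orthogonal_iff_disjoint hω.1.isRefl, Submodule.disjoint_def]
    exact fun x hx hx' => hU x hx fun y hy => hω.1.isRefl _ _ (hx' y hy)
  by_contra! h
  refine hind ⟨U, ω.orthogonal U, hc, fun x hx y hy => hy x hx, hUΓ, ?_, h.2, ?_,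
    isSymplectic_restrict hω.1 hU, isSymplectic_restrict hω.1 ?_⟩
  · intro g hg x hx y hy
    have h1 := hx (g⁻¹ y) (hUΓ _ (Γ.inv_mem hg) y hy)
    have h2 := hΓ hg (g⁻¹ y) x
    have h3 : g (g⁻¹ y) = y := g.apply_symm_apply y
    rw [h3] at h2
    exact h2.trans h1
  · intro h'
    rw [h'] at hc
    exact h.1 (by simpa using hc.inf_eq_bot)
  · intro x hx hx'
    refine hω.2.1 x fun y => ?_
    obtain ⟨u, hu, v, hv, rfl⟩ := Submodule.mem_sup.1 (hc.sup_eq_top ▸ Submodule.mem_top : y ∈ _)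
    rw [map_add, hx' v hv, hω.1.isRefl _ _ (hx u hu), add_zero]

/-- In an indecomposable triple, a self-adjoint endomorphism commuting with `Γ` vanishes if its
square does. Otherwise let `W` be a stable complement of its kernel. The form `ω` is
nondegenerate on `(1 + c M) W` for all but finitely many `c`, since `ω (M x, y)` is a nondegenerate
form on `W`. -/
lemma Indecomposable.eq_zero_of_sq_eq_zero [Finite Γ] (hω : IsSymplectic ω) (hΓ : Γ ≤ Sp ω)
    (hind : Indecomposable Γ ω) {M : Module.End ℂ V} (hadj : ∀ x y, ω (M x) y = ω x (M y))
    (hcomm : ∀ g ∈ Γ, ∀ x, M (g x) = g (M x)) (hsq : M ^ 2 = 0) : M = 0 := by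
  have hMM : ∀ x, M (M x) = 0 := fun x => by
    have h := LinearMap.congr_fun hsq x
    rwa [pow_two] at h
  obtain ⟨W, hWΓ, hW⟩ := exists_stable_isCompl (Γ := Γ) (U := LinearMap.ker M) (by
    intro g hg x hx
    rw [LinearMap.mem_ker] at hx ⊢
    rw [hcomm g hg, hx, map_zero])
  let B₁ := ω.restrict W
  let B₂ := LinearMap.BilinForm.restrict (ω ∘ₗ M) W
  have hsep : ∀ w ∈ W, (∀ v ∈ W, ω (M w) v = 0) → w = 0 := by
    intro w hw h
    have hMw : M w = 0 := hω.2.1 _ fun y => by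
      obtain ⟨k, hk, v, hv, rfl⟩ :=
        Submodule.mem_sup.1 (hW.sup_eq_top ▸ Submodule.mem_top : y ∈ _)
      rw [map_add, h v hv, hadj, LinearMap.mem_ker.1 hk, map_zero, add_zero]
    exact (Submodule.disjoint_def.1 hW.disjoint) w hMw hw
  have hB₂ : B₂.Nondegenerate := by
    refine ⟨fun x hx => Subtype.ext (hsep x x.2 fun v hv => hx ⟨v, hv⟩), fun y hy => ?_⟩
    refine Subtype.ext (hsep y y.2 fun v hv => ?_)
    have h : ω (M v) y = 0 := hy ⟨v, hv⟩
    rw [hadj, ← hω.1.neg_eq, h, neg_zero]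
  let T := LinearMap.BilinForm.symmCompOfNondegenerate B₁ B₂ hB₂
  have hT : ∀ w v, B₂ (T w) v = B₁ w v := fun w v =>
    LinearMap.BilinForm.symmCompOfNondegenerate_left_apply B₁ hB₂ v w
  obtain ⟨μ, hμ⟩ := (Module.End.finite_hasEigenvalue (R := ℂ) T).infinite_compl.nonempty
  obtain ⟨c, rfl⟩ : ∃ c : ℂ, -(2 * c) = μ := ⟨-(μ / 2), by ring⟩
  have hform : ∀ w v : W, ω (w + c • M w) (v + c • M v) = B₂ (T w + (2 * c) • w) v := by
    intro w v
    have h1 : ω (M (w : V)) (M v) = 0 := by rw [← hadj, hMM, map_zero, LinearMap.zero_apply]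
    have h2 : B₁ w v = ω w v := rfl
    have h3 : B₂ w v = ω (M w) v := rfl
    rw [map_add B₂, LinearMap.add_apply, map_smul, LinearMap.smul_apply, hT, h2, h3]
    simp only [map_add, map_smul, LinearMap.add_apply, LinearMap.smul_apply, h1, ← hadj,
      smul_eq_mul]
    ring
  let P : V →ₗ[ℂ] V := LinearMap.id + c • M
  have hP : ∀ x, P x = x + c • M x := fun x => rfl
  have hstable : ∀ g ∈ Γ, ∀ x ∈ W.map P, g x ∈ W.map P := by
    rintro g hg _ ⟨w, hw, rfl⟩
    refine ⟨g w, hWΓ g hg w hw, ?_⟩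
    rw [hP, hP, hcomm g hg, map_add, map_smul]
  have hnondeg : ∀ x ∈ W.map P, (∀ y ∈ W.map P, ω x y = 0) → x = 0 := by
    rintro _ ⟨w, hw, rfl⟩ h
    have h1 : T ⟨w, hw⟩ + (2 * c) • ⟨w, hw⟩ = 0 := hB₂.1 _ fun v => by
      rw [← hform]
      exact h _ ⟨v, v.2, rfl⟩
    have h2 : (⟨w, hw⟩ : W) = 0 := by
      by_contra hne
      refine hμ (Module.End.hasEigenvalue_of_hasEigenvector (x := ⟨w, hw⟩)
        ⟨Module.End.mem_eigenspace_iff.2 ?_, hne⟩)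
      rw [neg_smul, eq_neg_iff_add_eq_zero, h1]
    rw [show w = 0 from congrArg Subtype.val h2, map_zero]
  rcases hind.eq_bot_or_eq_top hω hΓ hstable hnondeg with h | h
  · have hW0 : W = ⊥ := by
      rw [eq_bot_iff]
      intro w hw
      have h0 : P w ∈ W.map P := Submodule.mem_map_of_mem hw
      rw [h, Submodule.mem_bot] at h0
      have h1 : M w = 0 := by
        have := congrArg M h0
        rwa [hP, map_add, map_smul, hMM, smul_zero, add_zero, map_zero] at this
      rwa [hP, h1, smul_zero, add_zero] at h0
    rw [hW0] at hW
    exact LinearMap.ker_eq_top.1 (by simpa using hW.sup_eq_top)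
  · have hWtop : ∀ x, x ∈ W := by
      intro x
      obtain ⟨w, hw, hwx⟩ : P x ∈ W.map P := h ▸ Submodule.mem_top
      have h1 : P (w - x) = 0 := by rw [map_sub, hwx, sub_self]
      have h2 : M (w - x) = 0 := by
        have := congrArg M h1
        rwa [hP, map_add, map_smul, hMM, smul_zero, add_zero, map_zero] at this
      rw [hP, h2, smul_zero, add_zero, sub_eq_zero] at h1
      exact h1 ▸ hw
    ext x
    exact (Submodule.disjoint_def.1 hW.disjoint) (M x) (hMM x) (hWtop _)

/-- In an indecomposable triple the invariant alternating forms are the multiples of `ω`. -/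
theorem Indecomposable.exists_eq_smul [Finite Γ] (hω : IsSymplectic ω) (hΓ : Γ ≤ Sp ω)
    (hind : Indecomposable Γ ω) {β : LinearMap.BilinForm ℂ V} (hβ : ∀ x y, β x y = -β y x)
    (hβΓ : ∀ g ∈ Γ, ∀ x y, β (g x) (g y) = β x y) : ∃ t : ℂ, ∀ x y, β x y = t * ω x y := by
  rcases subsingleton_or_nontrivial V with hV | hV
  · refine ⟨0, fun x y => ?_⟩
    rw [Subsingleton.elim x 0, map_zero, LinearMap.zero_apply, zero_mul]
  let A : Module.End ℂ V := LinearMap.BilinForm.symmCompOfNondegenerate β ω hω.2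
  have hA : ∀ x y, ω (A x) y = β x y := fun x y =>
    LinearMap.BilinForm.symmCompOfNondegenerate_left_apply β hω.2 y x
  have hAadj : ∀ x y, ω (A x) y = ω x (A y) := fun x y => by
    rw [← hω.1.neg_eq (A y), hA, hA, hβ]
  have hAΓ : ∀ g ∈ Γ, ∀ x, A (g x) = g (A x) := by
    intro g hg x
    rw [← sub_eq_zero]
    refine hω.2.1 _ fun y => ?_
    obtain ⟨y, rfl⟩ := g.surjective y
    rw [map_sub, LinearMap.sub_apply, hA, hβΓ g hg, hΓ hg, hA, sub_self]
  obtain ⟨t, ht⟩ := Module.End.exists_eigenvalue A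
  let N : Module.End ℂ V := A - algebraMap ℂ _ t
  have hN : ∀ x, N x = A x - t • x := fun x => rfl
  have hpow : ∀ n : ℕ, (∀ x y, ω ((N ^ n) x) y = ω x ((N ^ n) y)) ∧
      ∀ g ∈ Γ, ∀ x, (N ^ n) (g x) = g ((N ^ n) x) := by
    intro n
    induction n with
    | zero => exact ⟨fun x y => rfl, fun g _ x => rfl⟩
    | succ n ih =>
      refine ⟨fun x y => ?_, fun g hg x => ?_⟩
      · have hNadj : ∀ x y, ω (N x) y = ω x (N y) := fun x y => by
          rw [hN, hN, map_sub, map_sub, LinearMap.sub_apply, hAadj, map_smul, map_smul,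
            LinearMap.smul_apply]
        rw [pow_succ, Module.End.mul_apply, ih.1, hNadj, ← Module.End.mul_apply, ← pow_succ',
          pow_succ]
      · rw [pow_succ', Module.End.mul_apply, ih.2 g hg, hN, hAΓ g hg, Module.End.mul_apply, hN,
          map_sub, map_smul]
  -- by the Fitting decomposition, `N` is nilpotent
  have hnil : IsNilpotent N := by
    obtain ⟨n, hn, hn1⟩ := ((LinearMap.eventually_isCompl_ker_pow_range_pow N).and
      (Filter.eventually_ge_atTop 1)).exists
    refine ⟨n, ?_⟩
    have hstable : ∀ g ∈ Γ, ∀ x ∈ LinearMap.ker (N ^ n), g x ∈ LinearMap.ker (N ^ n) := by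
      intro g hg x hx
      rw [LinearMap.mem_ker] at hx ⊢
      rw [(hpow n).2 g hg, hx, map_zero]
    have hnondeg : ∀ x ∈ LinearMap.ker (N ^ n),
        (∀ y ∈ LinearMap.ker (N ^ n), ω x y = 0) → x = 0 := by
      intro x hx h
      refine hω.2.1 x fun y => ?_
      obtain ⟨k, hk, _, ⟨v, rfl⟩, rfl⟩ :=
        Submodule.mem_sup.1 (hn.sup_eq_top ▸ Submodule.mem_top : y ∈ _)
      rw [map_add, h k hk, ← (hpow n).1, LinearMap.mem_ker.1 hx, map_zero, LinearMap.zero_apply,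
        add_zero]
    rcases hind.eq_bot_or_eq_top hω hΓ hstable hnondeg with h | h
    · obtain ⟨x, hx⟩ := ht.exists_hasEigenvector
      refine absurd ((Submodule.mem_bot ℂ).1 (h ▸ ?_ : x ∈ _)) hx.2
      have hNx : N x = 0 := by rw [hN, hx.apply_eq_smul, sub_self]
      obtain ⟨m, rfl⟩ := Nat.exists_eq_add_of_le' hn1
      rw [LinearMap.mem_ker, pow_succ, Module.End.mul_apply, hNx, map_zero]
    · exact LinearMap.ker_eq_top.1 h
  have hN0 : N = 0 := by
    by_contra hne
    have h1 : N ^ (nilpotencyClass N - 1) ≠ 0 := pow_pred_nilpotencyClass hnil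
    have h2 : 2 ≤ nilpotencyClass N := by
      by_contra! hlt
      refine hne ?_
      have h := pow_nilpotencyClass hnil
      interval_cases hk : nilpotencyClass N
      · exact absurd h (by simp)
      · simpa using h
    refine h1 (hind.eq_zero_of_sq_eq_zero hω hΓ (hpow _).1 (hpow _).2 ?_)
    rw [← pow_mul]
    exact pow_eq_zero_of_le (by omega) (pow_nilpotencyClass hnil)
  refine ⟨t, fun x y => ?_⟩
  have h := LinearMap.congr_fun hN0 x
  rw [hN, LinearMap.zero_apply, sub_eq_zero] at h
  rw [← hA, h, map_smul, LinearMap.smul_apply, smul_eq_mul]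

end

section

variable {V : Type*} [AddCommGroup V] [Module ℂ V]

/-! ### Forms satisfying the Jacobi identity -/

section JacobiForm

variable {β : LinearMap.BilinForm ℂ V} {D : V →ₗ[ℂ] V}

/-- The identity `β(x, y) D z + β(y, z) D x + β(z, x) D y = 0`, which the Jacobi identity for `κ`
demands of the coefficient `β` of `g` in `κ`, where `D = Id - g`. -/
def JacobiForm (β : LinearMap.BilinForm ℂ V) (D : V →ₗ[ℂ] V) : Prop :=
  ∀ x y z, β x y • D z + β y z • D x + β z x • D y = 0

lemma JacobiForm.eq_zero_of_finrank_lt (h : JacobiForm β D) {x y : V}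
    (hxy : Module.finrank ℂ (Submodule.span ℂ {D x, D y}) < Module.finrank ℂ (LinearMap.range D)) :
    β x y = 0 := by
  have hz : ∃ z, D z ∉ Submodule.span ℂ {D x, D y} := by
    by_contra! hz
    have hle : LinearMap.range D ≤ Submodule.span ℂ {D x, D y} := by
      rintro _ ⟨z, rfl⟩
      exact hz z
    have : FiniteDimensional ℂ (Submodule.span ℂ {D x, D y}) :=
      FiniteDimensional.span_of_finite ℂ (Set.toFinite _)
    exact absurd (Submodule.finrank_mono hle) hxy.not_ge
  obtain ⟨z, hz⟩ := hz
  by_contra hne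
  refine hz ?_
  have h1 : β x y • D z ∈ Submodule.span ℂ {D x, D y} := by
    have h2 := h x y z
    rw [add_assoc, add_eq_zero_iff_eq_neg] at h2
    rw [h2]
    exact neg_mem (add_mem (Submodule.smul_mem _ _ (Submodule.subset_span (by simp)))
      (Submodule.smul_mem _ _ (Submodule.subset_span (by simp))))
  exact (Submodule.smul_mem_iff _ hne).1 h1

lemma JacobiForm.eq_zero_of_two_lt (h : JacobiForm β D)
    (hD : 2 < Module.finrank ℂ (LinearMap.range D)) (x y : V) : β x y = 0 := by
  classical
  refine h.eq_zero_of_finrank_lt (lt_of_le_of_lt ?_ hD)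
  have h2 := finrank_span_finset_le_card (R := ℂ) ({D x, D y} : Finset V)
  rw [Finset.coe_pair] at h2
  exact h2.trans Finset.card_le_two

lemma JacobiForm.eq_zero_of_mem_ker (h : JacobiForm β D)
    (hD : 2 ≤ Module.finrank ℂ (LinearMap.range D)) {x : V} (hx : x ∈ LinearMap.ker D) (y : V) :
    β x y = 0 := by
  refine h.eq_zero_of_finrank_lt (lt_of_le_of_lt ?_ hD)
  rw [LinearMap.mem_ker.1 hx, Submodule.span_insert_zero]
  have h2 := finrank_span_finset_le_card (R := ℂ) ({D y} : Finset V)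
  rwa [Finset.coe_singleton] at h2

end JacobiForm

/-- Two alternating forms on a plane are proportional. -/
lemma exists_eq_mul_of_finrank_eq_two {W : Type*} [AddCommGroup W] [Module ℂ W]
    (hW : Module.finrank ℂ W = 2) {α β : LinearMap.BilinForm ℂ W} (hα : α.IsAlt) (hβ : β.IsAlt)
    (hα0 : α ≠ 0) : ∃ c : ℂ, ∀ x y, β x y = c * α x y := by
  have : FiniteDimensional ℂ W := .of_finrank_pos (by omega)
  let e := Module.finBasisOfFinrankEq ℂ W hW
  have key : ∀ {γ : LinearMap.BilinForm ℂ W}, γ.IsAlt → ∀ x y,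
      γ x y = (e.repr x 0 * e.repr y 1 - e.repr x 1 * e.repr y 0) * γ (e 0) (e 1) := by
    intro γ hγ x y
    conv_lhs => rw [← e.sum_repr x, ← e.sum_repr y]
    simp only [Fin.sum_univ_two, map_add, map_smul, LinearMap.add_apply, LinearMap.smul_apply,
      hγ (e 0), hγ (e 1), ← hγ.neg_eq (e 0) (e 1), smul_eq_mul]
    ring
  have h01 : α (e 0) (e 1) ≠ 0 := by
    intro h
    refine hα0 (LinearMap.ext₂ fun x y => ?_)
    rw [key hα, h, mul_zero]; rfl
  refine ⟨β (e 0) (e 1) / α (e 0) (e 1), fun x y => ?_⟩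
  rw [key hβ x, key hα x]
  field_simp

/-- On a plane every alternating form satisfies the Jacobi identity. -/
lemma jacobi_of_finrank_eq_two {W U : Type*} [AddCommGroup W] [Module ℂ W] [AddCommGroup U]
    [Module ℂ U] (hW : Module.finrank ℂ W = 2) {α : LinearMap.BilinForm ℂ W} (hα : α.IsAlt)
    (D : W →ₗ[ℂ] U) (x y z : W) : α x y • D z + α y z • D x + α z x • D y = 0 := by
  have : FiniteDimensional ℂ W := .of_finrank_pos (by omega)
  let e := Module.finBasisOfFinrankEq ℂ W hW
  rw [← e.sum_repr x, ← e.sum_repr y, ← e.sum_repr z]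
  simp only [Fin.sum_univ_two, map_add, map_smul, LinearMap.add_apply, LinearMap.smul_apply,
    hα (e 0), hα (e 1), ← hα.neg_eq (e 0) (e 1), smul_eq_mul]
  module

/-! ### Symplectic reflections and their forms -/

variable {Γ : Subgroup (V ≃ₗ[ℂ] V)} {ω : LinearMap.BilinForm ℂ V}

lemma idSub_conj (g s : Γ) (x : V) :
    idSub ((g * s * g⁻¹ : Γ) : V ≃ₗ[ℂ] V) ((g : V ≃ₗ[ℂ] V) x) =
      (g : V ≃ₗ[ℂ] V) (idSub (s : V ≃ₗ[ℂ] V) x) := by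
  have h : ((g * s * g⁻¹ : Γ) : V ≃ₗ[ℂ] V) ((g : V ≃ₗ[ℂ] V) x) =
      (g : V ≃ₗ[ℂ] V) ((s : V ≃ₗ[ℂ] V) x) := by
    change (g : V ≃ₗ[ℂ] V) ((s : V ≃ₗ[ℂ] V) ((g : V ≃ₗ[ℂ] V).symm ((g : V ≃ₗ[ℂ] V) x))) = _
    rw [LinearEquiv.symm_apply_apply]
  change _ - _ = (g : V ≃ₗ[ℂ] V) (_ - _)
  rw [map_sub]
  exact congrArg _ h

lemma range_idSub_conj (g s : Γ) :
    LinearMap.range (idSub ((g * s * g⁻¹ : Γ) : V ≃ₗ[ℂ] V)) =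
      (LinearMap.range (idSub (s : V ≃ₗ[ℂ] V))).map ((g : V ≃ₗ[ℂ] V) : V →ₗ[ℂ] V) := by
  ext v
  constructor
  · rintro ⟨x, rfl⟩
    obtain ⟨x, rfl⟩ := (g : V ≃ₗ[ℂ] V).surjective x
    exact ⟨_, ⟨x, rfl⟩, (idSub_conj g s x).symm⟩
  · rintro ⟨_, ⟨x, rfl⟩, rfl⟩
    exact ⟨_, idSub_conj g s x⟩

lemma conj_mem_reflections_iff (g s : Γ) : g * s * g⁻¹ ∈ reflections Γ ↔ s ∈ reflections Γ := by
  change Module.finrank ℂ _ = 2 ↔ Module.finrank ℂ _ = 2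
  rw [range_idSub_conj, LinearEquiv.finrank_map_eq]

lemma one_notMem_reflections : (1 : Γ) ∉ reflections Γ := by
  intro h
  have h' : Module.finrank ℂ (LinearMap.range (idSub ((1 : Γ) : V ≃ₗ[ℂ] V))) = 2 := h
  have h0 : idSub ((1 : Γ) : V ≃ₗ[ℂ] V) = 0 := by ext x; exact sub_self x
  rw [h0, LinearMap.range_zero, finrank_bot] at h'
  omega

variable [FiniteDimensional ℂ V]

lemma eq_one_of_finrank_eq_zero {s : Γ}
    (h : Module.finrank ℂ (LinearMap.range (idSub (s : V ≃ₗ[ℂ] V))) = 0) : s = 1 := by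
  have h1 := LinearMap.range_eq_bot.1 (Submodule.finrank_eq_zero.1 h)
  ext x
  have h2 : x - (s : V ≃ₗ[ℂ] V) x = 0 := LinearMap.congr_fun h1 x
  exact (sub_eq_zero.1 h2).symm

variable [Finite Γ]

lemma reflForm_apply (s : Γ) (x y : V) :
    reflForm ω s x y = ω (Submodule.projection _ _ (isCompl_coe s) x)
      (Submodule.projection _ _ (isCompl_coe s) y) := rfl

lemma idSub_projection (s : Γ) (x : V) :
    idSub (s : V ≃ₗ[ℂ] V) (Submodule.projection _ _ (isCompl_coe s) x) =
      idSub (s : V ≃ₗ[ℂ] V) x := by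
  have h := Submodule.sub_projection_mem (isCompl_coe s) x
  rw [LinearMap.mem_ker, map_sub, sub_eq_zero] at h
  exact h.symm

lemma projection_conj (g s : Γ) (x : V) :
    Submodule.projection _ _ (isCompl_coe (g * s * g⁻¹)) ((g : V ≃ₗ[ℂ] V) x) =
      (g : V ≃ₗ[ℂ] V) (Submodule.projection _ _ (isCompl_coe s) x) := by
  have h1 : (g : V ≃ₗ[ℂ] V) (Submodule.projection _ _ (isCompl_coe s) x) ∈
      LinearMap.range (idSub ((g * s * g⁻¹ : Γ) : V ≃ₗ[ℂ] V)) := by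
    rw [range_idSub_conj]
    exact Submodule.mem_map_of_mem (Submodule.projection_apply_mem _ _)
  have h2 : (g : V ≃ₗ[ℂ] V) (x - Submodule.projection _ _ (isCompl_coe s) x) ∈
      LinearMap.ker (idSub ((g * s * g⁻¹ : Γ) : V ≃ₗ[ℂ] V)) := by
    rw [LinearMap.mem_ker, idSub_conj, map_sub, idSub_projection, sub_self, map_zero]
  have h3 := (Submodule.projection_apply_eq_zero_iff (isCompl_coe (g * s * g⁻¹))).2 h2
  rw [map_sub, map_sub, sub_eq_zero,
    Submodule.projection_apply_of_mem_left (isCompl_coe (g * s * g⁻¹)) h1] at h3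
  exact h3

lemma reflForm_conj (hΓ : Γ ≤ Sp ω) (g s : Γ) (x y : V) :
    reflForm ω (g * s * g⁻¹) ((g : V ≃ₗ[ℂ] V) x) ((g : V ≃ₗ[ℂ] V) y) = reflForm ω s x y := by
  rw [reflForm_apply, reflForm_apply, projection_conj, projection_conj, hΓ g.2]

lemma reflForm_ne_zero (hω : IsSymplectic ω) (hΓ : Γ ≤ Sp ω) {s : Γ} (hs : s ∈ reflections Γ) :
    reflForm ω s ≠ 0 := by
  intro h
  have h1 := ker_reflForm hω hΓ s
  rw [h, LinearMap.ker_zero] at h1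
  have h2 := LinearMap.ker_eq_top.1 h1.symm
  have hs' : Module.finrank ℂ (LinearMap.range (idSub (s : V ≃ₗ[ℂ] V))) = 2 := hs
  rw [h2, LinearMap.range_zero, finrank_bot] at hs'
  omega

lemma finrank_range_idSub_ne_one (hω : IsSymplectic ω) (hΓ : Γ ≤ Sp ω) (s : Γ) :
    Module.finrank ℂ (LinearMap.range (idSub (s : V ≃ₗ[ℂ] V))) ≠ 1 := by
  intro h
  -- an alternating form vanishes on the line `Im (Id - s)`, so `ω_s = 0`
  have h0 : reflForm ω s = 0 := by
    obtain ⟨d, -, hd⟩ := finrank_eq_one_iff'.1 h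
    refine LinearMap.ext₂ fun x y => ?_
    obtain ⟨a, ha⟩ := hd ⟨_, Submodule.projection_apply_mem (isCompl_coe s) x⟩
    obtain ⟨b, hb⟩ := hd ⟨_, Submodule.projection_apply_mem (isCompl_coe s) y⟩
    have ha' := congrArg Subtype.val ha
    have hb' := congrArg Subtype.val hb
    simp only [Submodule.coe_smul] at ha' hb'
    rw [reflForm_apply, ← ha', ← hb']
    simp [hω.1 (d : V)]
  have h1 := ker_reflForm hω hΓ s
  rw [h0, LinearMap.ker_zero] at h1
  rw [LinearMap.ker_eq_top.1 h1.symm, LinearMap.range_zero, finrank_bot] at h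
  omega

/-- For a symplectic reflection `s` the form `ω_s` satisfies the Jacobi identity. -/
lemma jacobiForm_reflForm (hω : IsSymplectic ω) {s : Γ} (hs : s ∈ reflections Γ) :
    JacobiForm (reflForm ω s) (idSub (s : V ≃ₗ[ℂ] V)) := by
  intro x y z
  have h := jacobi_of_finrank_eq_two (α := ω.restrict _) hs (fun x => hω.1 x)
    ((idSub (s : V ≃ₗ[ℂ] V)).domRestrict _)
    ⟨_, Submodule.projection_apply_mem (isCompl_coe s) x⟩
    ⟨_, Submodule.projection_apply_mem (isCompl_coe s) y⟩
    ⟨_, Submodule.projection_apply_mem (isCompl_coe s) z⟩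
  simp only [LinearMap.domRestrict_apply, idSub_projection] at h
  exact h

/-- For a symplectic reflection `s` the alternating forms that satisfy the Jacobi identity are
multiples of `ω_s`. -/
lemma JacobiForm.exists_eq_mul_reflForm (hω : IsSymplectic ω) (hΓ : Γ ≤ Sp ω) {s : Γ}
    (hs : s ∈ reflections Γ) {β : LinearMap.BilinForm ℂ V} (hβ : β.IsAlt)
    (h : JacobiForm β (idSub (s : V ≃ₗ[ℂ] V))) : ∃ c : ℂ, ∀ x y, β x y = c * reflForm ω s x y := by
  have hs' : Module.finrank ℂ (LinearMap.range (idSub (s : V ≃ₗ[ℂ] V))) = 2 := hs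
  have hne : ω.restrict (LinearMap.range (idSub (s : V ≃ₗ[ℂ] V))) ≠ 0 := by
    intro h0
    refine reflForm_ne_zero hω hΓ hs (LinearMap.ext₂ fun x y => ?_)
    exact LinearMap.congr_fun₂ h0 ⟨_, Submodule.projection_apply_mem (isCompl_coe s) x⟩
      ⟨_, Submodule.projection_apply_mem (isCompl_coe s) y⟩
  obtain ⟨c, hc⟩ := exists_eq_mul_of_finrank_eq_two (β := β.restrict _) hs' (fun x => hω.1 x)
    (fun x => hβ x) hne
  refine ⟨c, fun x y => ?_⟩
  have hx := h.eq_zero_of_mem_ker hs'.ge (Submodule.sub_projection_mem (isCompl_coe s) x) y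
  have hy := h.eq_zero_of_mem_ker hs'.ge (Submodule.sub_projection_mem (isCompl_coe s) y)
    (Submodule.projection _ _ (isCompl_coe s) x)
  rw [map_sub, LinearMap.sub_apply, sub_eq_zero] at hx
  rw [← hβ.neg_eq, neg_eq_zero, map_sub, sub_eq_zero] at hy
  rw [hx, hy, reflForm_apply]
  exact hc ⟨_, Submodule.projection_apply_mem (isCompl_coe s) x⟩
    ⟨_, Submodule.projection_apply_mem (isCompl_coe s) y⟩

end

section

variable {V : Type*} [AddCommGroup V] [Module ℂ V] {Γ : Subgroup (V ≃ₗ[ℂ] V)}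

/-! ### Equivariant pairings satisfying the Jacobi identity -/

section Coefficients

variable (κ : V →ₗ[ℂ] V →ₗ[ℂ] MonoidAlgebra ℂ Γ)

/-- The coefficient of `g` in `κ`. -/
def coeffForm (g : Γ) : LinearMap.BilinForm ℂ V :=
  κ.compr₂ (Finsupp.lapply g ∘ₗ (MonoidAlgebra.coeffLinearEquiv ℂ).toLinearMap)

lemma coeffForm_apply (g : Γ) (x y : V) : coeffForm κ g x y = (κ x y).coeff g := rfl

variable {κ}

lemma jacobi_iff : Jacobi κ ↔ ∀ g : Γ, JacobiForm (coeffForm κ g) (idSub (g : V ≃ₗ[ℂ] V)) := by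
  refine forall_congr' fun g => forall₃_congr fun x y z => ?_
  have h : ∀ x, idSub (g : V ≃ₗ[ℂ] V) x = -((g : V ≃ₗ[ℂ] V) x - x) := fun x =>
    (neg_sub _ _).symm
  rw [h, h, h, smul_neg, smul_neg, smul_neg, ← neg_add, ← neg_add, neg_eq_zero]
  rfl

lemma equivariant_iff : Equivariant κ ↔ ∀ (g s : Γ) (x y : V),
    coeffForm κ (g * s * g⁻¹) ((g : V ≃ₗ[ℂ] V) x) ((g : V ≃ₗ[ℂ] V) y) = coeffForm κ s x y := by
  have h1 : ∀ (g s : Γ) (a : MonoidAlgebra ℂ Γ),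
      (MonoidAlgebra.of ℂ Γ g * a).coeff (g * s) = a.coeff s := fun g s a => by
    simp [MonoidAlgebra.of_apply]
  have h2 : ∀ (g s : Γ) (a : MonoidAlgebra ℂ Γ),
      (a * MonoidAlgebra.of ℂ Γ g).coeff (g * s) = a.coeff (g * s * g⁻¹) := fun g s a => by
    simp [MonoidAlgebra.of_apply]
  constructor
  · intro h g s x y
    have h3 := congrArg (fun a => MonoidAlgebra.coeff a (g * s)) (h g x y)
    simp only [h1, h2] at h3
    exact h3.symm
  · intro h g x y
    ext s
    obtain ⟨s, rfl⟩ : ∃ s', g * s' = s := ⟨g⁻¹ * s, mul_inv_cancel_left g s⟩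
    rw [h1, h2]
    exact (h g s x y).symm

lemma coeff_add_finsum [Finite Γ] (τ : ℂ) (a : Γ → ℂ) (R : Set Γ) (g : Γ) [Decidable (g = 1)]
    [Decidable (g ∈ R)] :
    (τ • (1 : MonoidAlgebra ℂ Γ) +
      ∑ᶠ s : R, a s • MonoidAlgebra.of ℂ Γ (s : Γ)).coeff g =
      (if g = 1 then τ else 0) + if g ∈ R then a g else 0 := by
  classical
  have := Fintype.ofFinite R
  rw [finsum_eq_sum_of_fintype, MonoidAlgebra.coeff_add, Finsupp.add_apply, MonoidAlgebra.coeff_sum,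
    Finsupp.finsetSum_apply]
  congr 1
  · rw [MonoidAlgebra.coeff_smul, Finsupp.smul_apply, MonoidAlgebra.one_def,
      MonoidAlgebra.coeff_single, Finsupp.single_apply]
    simp [eq_comm]
  · simp only [MonoidAlgebra.coeff_smul, MonoidAlgebra.of_apply, Finsupp.smul_apply,
      MonoidAlgebra.coeff_single, Finsupp.single_apply, smul_eq_mul, mul_ite, mul_one, mul_zero]
    split_ifs with hg
    · rw [Finset.sum_eq_single ⟨g, hg⟩]
      · simp
      · intro s _ hs
        rw [if_neg fun h => hs (Subtype.ext h)]
      · exact fun h => absurd (Finset.mem_univ _) h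
    · exact Finset.sum_eq_zero fun s _ => if_neg fun (h : (s : Γ) = g) => hg (h ▸ s.2)

lemma isAlt_coeffForm (hκ : ∀ x y : V, κ x y = -κ y x) (g : Γ) : (coeffForm κ g).IsAlt := by
  intro x
  have h := congrArg (fun a => MonoidAlgebra.coeff a g) (hκ x x)
  exact self_eq_neg.1 h

end Coefficients

variable [FiniteDimensional ℂ V] [Finite Γ] {ω : LinearMap.BilinForm ℂ V}
  {κ : V →ₗ[ℂ] V →ₗ[ℂ] MonoidAlgebra ℂ Γ}

/-- An equivariant pairing that satisfies the Jacobi identity is supported on `1` and on the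
symplectic reflections, with the coefficients that the theorem asserts. -/
theorem exists_of_equivariant_of_jacobi (hω : IsSymplectic ω) (hΓ : Γ ≤ Sp ω)
    (hind : Indecomposable Γ ω) (hκ : ∀ x y : V, κ x y = -κ y x) (hE : Equivariant κ)
    (hJ : Jacobi κ) :
    ∃ (t : ℂ) (c : reflections Γ → ℂ),
      (∀ (g : Γ) (s s' : reflections Γ), (s' : Γ) = g * s * g⁻¹ → c s' = c s) ∧
      ∀ x y : V, κ x y = (t * ω x y) • (1 : MonoidAlgebra ℂ Γ) +
        ∑ᶠ s : reflections Γ,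
          (c s * reflForm ω (s : Γ) x y) • MonoidAlgebra.of ℂ Γ (s : Γ) := by
  classical
  rw [equivariant_iff] at hE
  rw [jacobi_iff] at hJ
  obtain ⟨t, ht⟩ := hind.exists_eq_smul hω hΓ (β := coeffForm κ 1)
    (fun x y => ((isAlt_coeffForm hκ 1).neg_eq y x).symm) (fun g hg x y => by
      have h := hE ⟨g, hg⟩ 1 x y
      rwa [mul_one, mul_inv_cancel] at h)
  choose c hc using fun s : reflections Γ =>
    (hJ s).exists_eq_mul_reflForm hω hΓ s.2 (isAlt_coeffForm hκ s)
  refine ⟨t, c, ?_, fun x y => ?_⟩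
  · rintro g ⟨s, hs⟩ ⟨_, hs'⟩ rfl
    have hne : ∃ x y, reflForm ω s x y ≠ 0 := by
      by_contra! h
      exact reflForm_ne_zero hω hΓ hs (LinearMap.ext₂ h)
    obtain ⟨x, y, hxy⟩ := hne
    refine mul_right_cancel₀ hxy ?_
    rw [← hc ⟨s, hs⟩, ← hE g, hc ⟨_, hs'⟩, reflForm_conj hΓ]
  · ext g
    have hsum := coeff_add_finsum (t * ω x y)
      (fun s => if h : s ∈ reflections Γ then c ⟨s, h⟩ * reflForm ω s x y else 0)
      (reflections Γ) g
    simp only [Subtype.coe_prop, dite_true, Subtype.coe_eta] at hsum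
    rw [hsum, ← coeffForm_apply]
    by_cases h1 : g = 1
    · subst h1
      rw [if_pos rfl, if_neg one_notMem_reflections, add_zero, ht]
    rw [if_neg h1, zero_add]
    by_cases hg : g ∈ reflections Γ
    · rw [if_pos hg, dif_pos hg, hc ⟨g, hg⟩]
    rw [if_neg hg]
    refine (hJ g).eq_zero_of_two_lt ?_ x y
    have h0 : Module.finrank ℂ (LinearMap.range (idSub (g : V ≃ₗ[ℂ] V))) ≠ 0 :=
      fun h => h1 (eq_one_of_finrank_eq_zero h)
    have h1' := finrank_range_idSub_ne_one hω hΓ g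
    have h2 : Module.finrank ℂ (LinearMap.range (idSub (g : V ≃ₗ[ℂ] V))) ≠ 2 := hg
    omega

theorem equivariant_and_jacobi_of_eq (hω : IsSymplectic ω) (hΓ : Γ ≤ Sp ω)
    {t : ℂ} {c : reflections Γ → ℂ}
    (hc : ∀ (g : Γ) (s s' : reflections Γ), (s' : Γ) = g * s * g⁻¹ → c s' = c s)
    (h : ∀ x y : V, κ x y = (t * ω x y) • (1 : MonoidAlgebra ℂ Γ) +
        ∑ᶠ s : reflections Γ,
          (c s * reflForm ω (s : Γ) x y) • MonoidAlgebra.of ℂ Γ (s : Γ)) :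
    Equivariant κ ∧ Jacobi κ := by
  classical
  let c' : Γ → ℂ := fun s => if h : s ∈ reflections Γ then c ⟨s, h⟩ else 0
  have hc' : ∀ g s : Γ, c' (g * s * g⁻¹) = c' s := by
    intro g s
    by_cases hs : s ∈ reflections Γ
    · have hs' := (conj_mem_reflections_iff g s).2 hs
      simp only [c', dif_pos hs, dif_pos hs']
      exact hc g ⟨s, hs⟩ ⟨_, hs'⟩ rfl
    · simp only [c', dif_neg hs, dif_neg (mt (conj_mem_reflections_iff g s).1 hs)]
  have hcoeff : ∀ (g : Γ) (x y : V), coeffForm κ g x y =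
      (if g = 1 then t * ω x y else 0) +
        if g ∈ reflections Γ then c' g * reflForm ω g x y else 0 := by
    intro g x y
    have hsum := coeff_add_finsum (t * ω x y) (fun s => c' s * reflForm ω s x y) (reflections Γ) g
    rw [coeffForm_apply, h x y, ← hsum]
    simp only [c', Subtype.coe_prop, dite_true, Subtype.coe_eta]
  refine ⟨equivariant_iff.2 fun g s x y => ?_, jacobi_iff.2 fun g x y z => ?_⟩
  · rw [hcoeff, hcoeff, hc', reflForm_conj hΓ, hΓ g.2]
    simp only [conj_mem_reflections_iff, conj_eq_one_iff]
  · by_cases h1 : g = 1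
    · subst h1
      have h0 : ∀ x, idSub ((1 : Γ) : V ≃ₗ[ℂ] V) x = 0 := fun x => sub_self x
      simp only [h0, smul_zero, add_zero]
    · simp only [hcoeff, if_neg h1, zero_add]
      by_cases hg : g ∈ reflections Γ
      · simp only [if_pos hg, mul_smul, ← smul_add]
        rw [jacobiForm_reflForm hω hg x y z, smul_zero]
      · simp only [if_neg hg, zero_smul, add_zero]

end

end SymplecticReflection

end

open SymplecticReflection in
theorem theorem1p3 {V : Type*} [AddCommGroup V] [Module ℂ V] [FiniteDimensional ℂ V]
    (ω : LinearMap.BilinForm ℂ V) (hω : IsSymplectic ω)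
    (Γ : Subgroup (V ≃ₗ[ℂ] V)) [Finite Γ] (hΓ : Γ ≤ Sp ω) (hind : Indecomposable Γ ω)
    (κ : V →ₗ[ℂ] V →ₗ[ℂ] MonoidAlgebra ℂ Γ) (hκ : ∀ x y : V, κ x y = -κ y x) :
    PBWProperty κ ↔
      ∃ (t : ℂ) (c : reflections Γ → ℂ),
        (∀ (g : Γ) (s s' : reflections Γ), (s' : Γ) = g * s * g⁻¹ → c s' = c s) ∧
        ∀ x y : V, κ x y = (t * ω x y) • (1 : MonoidAlgebra ℂ Γ) +
          ∑ᶠ s : reflections Γ,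
            (c s * reflForm ω (s : Γ) x y) • MonoidAlgebra.of ℂ Γ (s : Γ) := by
  rw [pbwProperty_iff_jacobi hκ]
  exact ⟨fun h => exists_of_equivariant_of_jacobi hω hΓ hind hκ h.1 h.2,
    fun ⟨_, _, hc, h⟩ => equivariant_and_jacobi_of_eq hω hΓ hc h⟩
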